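/- For each $n\ge 1$ let $\Omega_n=\{0,1,\dots,n\}$ and let $K_n$ be an irreducible birth and death chain on $\Omega_n$ with birth, death and holding rates $p_{n,i},q_{n,i},r_{n,i}\ge 0$, that is, $K_n(i,i+1)=p_{n,i}$, $K_n(i,i-1)=q_{n,i}$, $K_n(i,i)=r_{n,i}$, $p_{n,i}+q_{n,i}+r_{n,i}=1$ and $p_{n,n}=q_{n,0}=0$. Let $\pi_n$ be its stationary distribution and $\lambda_n$ its spectral gap (the smallest non-zero eigenvalue of $I-K_n$), and write $\pi_n(A)=\sum_{i\in A}\pi_n(i)$. For $\delta\in(0,1)$ let $d_n^{(\delta)}(m)=\max_x\|K_{n,\delta}^m(x,\cdot)-\pi_n\|_{TV}$, $m\in\{0,1,2,\dots\}$, be the total variation distance of the lazy chain $K_{n,\delta}=\delta I+(1-\delta)K_n$, let $d_n^{(c)}(t)$, $t\ge 0$, be that of the continuous time semigroup $e^{-t(I-K_n)}$, and let $T_n^{(\delta)}(\epsilon)=\min\{m\ge 0: d_n^{(\delta)}(m)\le\epsilon\}$ and $T_n^{(c)}(\epsilon)=\inf\{t\ge 0: d_n^{(c)}(t)\le\epsilon\}$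 be the mixing times. For sequences $s_n,t_n\ge0$, $s_n\asymp t_n$ means that there are $C,N>0$ with $s_n\le Ct_n$ and $t_n\le Cs_n$ for all $n\ge N$. The family $(K_n)$ has a cutoff in continuous time if there are $t_n>0$ such that, for all $\epsilon\in(0,1)$, $d_n^{(c)}((1+\epsilon)t_n)\to0$ and $d_n^{(c)}((1-\epsilon)t_n)\to1$. It has a precutoff in continuous time if there are $t_n>0$ and $B>A>0$ with $d_n^{(c)}(Bt_n)\to0$ and $\liminf_n d_n^{(c)}(At_n)>0$. For the $\delta$-lazy chains cutoff and precutoff are defined in the same way with $d_n^{(\delta)}$, where the times $(1+\epsilon)t_n$ and $Bt_n$ are rounded up and the times $(1-\epsilon)t_n$ and $At_n$ are rounded down. **(Theorem 4.3)** Let $j_n\in\Omega_n$ be such that, for all $n\ge 1$, $$p_{n,i}\le q_{n,i+1}\ \ (0\le i<j_n),\qquad p_{n,i}\ge q_{n,i+1}\ \ (j_n\le i<n).$$ Assume that $\pi_n([0,j_n])\asymp\pi_n([j_n,n])$ and $$\max_{0<i\le j_n}q_{n,i}\asymp\min_{0<i\le j_n}q_{n,i},\qquad \max_{j_n\le i<n}p_{n,i}\asymp\min_{j_n\le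 i<n}p_{n,i}.$$ (The first assumption forces $0<j_n<n$ for all large $n$, so that these expressions make sense for all large $n$.) Then there is no cutoff, neither in continuous time nor for the $\delta$-lazy chains for any $\delta\in(0,1)$, and, for all $\epsilon\in(0,1/2)$ and $\delta\in(0,1)$, $$T_n^{(c)}(\epsilon)\asymp T_n^{(\delta)}(\epsilon)\asymp\frac1{\lambda_n}\asymp\max\Big\{\frac1{q_{n,j_n}}\sum_{i=0}^{j_n}\frac1{\pi_n(i)},\ \frac1{p_{n,j_n}}\sum_{i=j_n}^{n}\frac1{\pi_n(i)}\Big\}.$$ **(Theorem 4.4)** For $n\ge1$ let $\pi_n$ be a positive probability distribution on $\Omega_n$ and $j_n\in\Omega_n$ such that $\pi_n(i)\ge\pi_n(i+1)$ for $0\le i<j_n$ and $\pi_n(i)\le\pi_n(i+1)$ for $j_n\le i<n$, and let $K_n$ be the Metropolis chain for $\pi_n$, that is, the birth and death chain with $$q_{n,i}=\tfrac12\ (0<i\le j_n),\quad p_{n,i}=\tfrac12\ (j_n\le i<n),\quad p_{n,i}=\frac{\pi_n(i+1)}{2\pi_n(i)}\ (i<j_n),\quad q_{n,i}=\frac{\pi_n(i-1)}{2\pi_n(i)}\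 (i>j_n),$$ $p_{n,n}=q_{n,0}=0$ and $r_{n,i}=1-p_{n,i}-q_{n,i}$. Suppose $\pi_n([0,j_n])\asymp\pi_n([j_n,n])$. Then there is no precutoff, neither in continuous time nor for the $\delta$-lazy chains for any $\delta\in(0,1)$, and, for all $\epsilon\in(0,1/2)$ and $\delta\in(0,1)$, $$T_n^{(c)}(\epsilon)\asymp\sum_{i=0}^n\frac1{\pi_n(i)}\asymp T_n^{(\delta)}(\epsilon),\qquad \frac1{\lambda_n}\asymp\sum_{i=0}^n\frac1{\pi_n(i)}.$$ -/

import Mathlib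

open Filter Asymptotics Topology

namespace BirthDeath

noncomputable section

/-! ### Mixing of a finite Markov chain with transition matrix `K` -/

/-- `π` is a stationary probability distribution of the transition matrix `K`. -/
structure IsStationaryDist {Ω : Type*} [Fintype Ω] (K : Matrix Ω Ω ℝ) (π : Ω → ℝ) : Prop where
  nonneg : ∀ x, 0 ≤ π x
  sum_eq_one : ∑ x, π x = 1
  vecMul_eq : Matrix.vecMul π K = π

/-- The transition matrix `δ I + (1 - δ) K` of the `δ`-lazy chain. -/
def lazyChain {Ω : Type*} [DecidableEq Ω] (δ : ℝ) (K : Matrix Ω Ω ℝ) : Matrix Ω Ω ℝ :=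
  δ • (1 : Matrix Ω Ω ℝ) + (1 - δ) • K

/-- The continuous time semigroup `H_t = exp (-t (I - K))`. -/
def semigroup {Ω : Type*} [Fintype Ω] [DecidableEq Ω] (K : Matrix Ω Ω ℝ) (t : ℝ) :
    Matrix Ω Ω ℝ :=
  NormedSpace.exp (-(t • (1 - K)))

/-- Total variation `sup {μ(A) - ν(A) | A ⊆ Ω}` on a finite set. -/
def tv {Ω : Type*} (μ ν : Ω → ℝ) : ℝ :=
  ⨆ A : Finset Ω, (∑ x ∈ A, μ x - ∑ x ∈ A, ν x)

/-- Maximum over the starting state of the total variation between `P(x, ·)` and `π`. -/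
def maxTV {Ω : Type*} (P : Matrix Ω Ω ℝ) (π : Ω → ℝ) : ℝ :=
  ⨆ x : Ω, tv (P x) π

/-- The total variation distance of the continuous time chain at time `t`. -/
def distCont {Ω : Type*} [Fintype Ω] [DecidableEq Ω] (K : Matrix Ω Ω ℝ) (π : Ω → ℝ)
    (t : ℝ) : ℝ :=
  maxTV (semigroup K t) π

/-- The total variation distance of the discrete time chain at time `m`. -/
def distDisc {Ω : Type*} [Fintype Ω] [DecidableEq Ω] (K : Matrix Ω Ω ℝ) (π : Ω → ℝ)
    (m : ℕ) : ℝ :=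
  maxTV (K ^ m) π

/-- The total variation mixing time of the continuous time chain. -/
def mixCont {Ω : Type*} [Fintype Ω] [DecidableEq Ω] (K : Matrix Ω Ω ℝ) (π : Ω → ℝ)
    (ε : ℝ) : ℝ :=
  sInf {t : ℝ | 0 ≤ t ∧ distCont K π t ≤ ε}

/-- The total variation mixing time of the discrete time chain. -/
def mixDisc {Ω : Type*} [Fintype Ω] [DecidableEq Ω] (K : Matrix Ω Ω ℝ) (π : Ω → ℝ)
    (ε : ℝ) : ℕ :=
  sInf {m : ℕ | distDisc K π m ≤ ε}

/-- The spectral gap: the smallest non-zero eigenvalue of `I - K`. -/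
def spectralGap {Ω : Type*} [Fintype Ω] [DecidableEq Ω] (K : Matrix Ω Ω ℝ) : ℝ :=
  sInf {l : ℝ | l ≠ 0 ∧ Module.End.HasEigenvalue (Matrix.toLin' (1 - K)) l}

/-! ### Cutoff and precutoff for a family of distance functions -/

/-- Cutoff of a family of continuous time distances `d n t`. -/
def HasCutoffCont (d : ℕ → ℝ → ℝ) : Prop :=
  ∃ t : ℕ → ℝ, (∀ n, 0 < t n) ∧ ∀ ε : ℝ, 0 < ε → ε < 1 →
    Tendsto (fun n => d n ((1 + ε) * t n)) atTop (𝓝 0) ∧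
    Tendsto (fun n => d n ((1 - ε) * t n)) atTop (𝓝 1)

/-- Cutoff of a family of discrete time distances `d n m`. -/
def HasCutoffDisc (d : ℕ → ℕ → ℝ) : Prop :=
  ∃ t : ℕ → ℝ, (∀ n, 0 < t n) ∧ ∀ ε : ℝ, 0 < ε → ε < 1 →
    Tendsto (fun n => d n ⌈(1 + ε) * t n⌉₊) atTop (𝓝 0) ∧
    Tendsto (fun n => d n ⌊(1 - ε) * t n⌋₊) atTop (𝓝 1)

/-- Precutoff of a family of continuous time distances `d n t`. -/
def HasPrecutoffCont (d : ℕ → ℝ → ℝ) : Prop :=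
  ∃ t : ℕ → ℝ, (∀ n, 0 < t n) ∧ ∃ A B : ℝ, 0 < A ∧ A < B ∧
    Tendsto (fun n => d n (B * t n)) atTop (𝓝 0) ∧
    0 < liminf (fun n => d n (A * t n)) atTop

/-- Precutoff of a family of discrete time distances `d n m`. -/
def HasPrecutoffDisc (d : ℕ → ℕ → ℝ) : Prop :=
  ∃ t : ℕ → ℝ, (∀ n, 0 < t n) ∧ ∃ A B : ℝ, 0 < A ∧ A < B ∧
    Tendsto (fun n => d n ⌈B * t n⌉₊) atTop (𝓝 0) ∧
    0 < liminf (fun n => d n ⌊A * t n⌋₊) atTop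

/-! ### Birth and death chains on `{0, ..., n}` -/

/-- `p`, `q`, `r` are birth, death and holding rates on `{0, ..., n}`. -/
structure IsRates {n : ℕ} (p q r : Fin (n + 1) → ℝ) : Prop where
  birth_nonneg : ∀ i, 0 ≤ p i
  death_nonneg : ∀ i, 0 ≤ q i
  hold_nonneg : ∀ i, 0 ≤ r i
  sum_eq_one : ∀ i, p i + q i + r i = 1
  birth_last : p (Fin.last n) = 0
  death_zero : q 0 = 0

/-- The birth and death transition matrix with birth, death and holding rates `p`, `q`, `r`. -/
def bdMatrix {n : ℕ} (p q r : Fin (n + 1) → ℝ) : Matrix (Fin (n + 1)) (Fin (n + 1)) ℝ :=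
  fun i k =>
    if (k : ℕ) = i + 1 then p i
    else if (k : ℕ) + 1 = i then q i
    else if k = i then r i
    else 0

/-- The valley condition at `j`: `p_i ≤ q_{i+1}` for `i < j` and `p_i ≥ q_{i+1}` for
`j ≤ i < n`. -/
def RatesValley {n : ℕ} (p q : Fin (n + 1) → ℝ) (j : Fin (n + 1)) : Prop :=
  ∀ i : Fin n, (i.castSucc < j → p i.castSucc ≤ q i.succ) ∧
    (j ≤ i.castSucc → q i.succ ≤ p i.castSucc)

/-- `π` decreases (weakly) on `{0, ..., j}` and increases (weakly) on `{j, ..., n}`. -/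
def DistValley {n : ℕ} (π : Fin (n + 1) → ℝ) (j : Fin (n + 1)) : Prop :=
  ∀ i : Fin n, (i.castSucc < j → π i.succ ≤ π i.castSucc) ∧
    (j ≤ i.castSucc → π i.castSucc ≤ π i.succ)

/-- Birth rates of the Metropolis chain for `π`, a distribution with a valley at `j`. In the last
branch `i < j ≤ n`, so that `i + 1` does not wrap around. -/
def metropolisBirth {n : ℕ} (π : Fin (n + 1) → ℝ) (j i : Fin (n + 1)) : ℝ :=
  if i = Fin.last n then 0 else if j ≤ i then 1 / 2 else π (i + 1) / (2 * π i)

/-- Death rates of the Metropolis chain for `π`, a distribution with a valley at `j`. In the last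
branch `0 ≤ j < i`, so that `i - 1` does not wrap around. -/
def metropolisDeath {n : ℕ} (π : Fin (n + 1) → ℝ) (j i : Fin (n + 1)) : ℝ :=
  if i = 0 then 0 else if i ≤ j then 1 / 2 else π (i - 1) / (2 * π i)

/-- The Metropolis chain for `π` (with a valley at `j`) associated to simple random walk on
`{0, ..., n}`. -/
def metropolis {n : ℕ} (π : Fin (n + 1) → ℝ) (j : Fin (n + 1)) :
    Matrix (Fin (n + 1)) (Fin (n + 1)) ℝ :=
  bdMatrix (metropolisBirth π j) (metropolisDeath π j)
    (fun i => 1 - metropolisBirth π j i - metropolisDeath π j i)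

end

end BirthDeath

open BirthDeath

/-!
The argument is analytic and treats continuous time and all lazy chains alike. Let `E` be the
Dirichlet form of a reversible chain and suppose that `(g x - π g)² ≤ R E(g)` for all `g` and `x`
(a uniform Poincaré inequality). By Cauchy-Schwarz along the path this holds for a birth and death
chain with `R` the effective resistance between the endpoints
(`IsReversibleRates.sq_sub_mean_le`).

*Upper bound.* Along the semigroup, `‖H_t f‖² + 2 t E(H_t f)` is non-increasing in `t`, so that
`E(H_t f) ≤ ‖f‖² / (2 t)`, and the same computation works for a `δ`-lazy chain with `δ (1 - δ) m` in
place of `t` (`IsReversible.semigroup_decay`, `IsReversible.lazyChain_pow_decay`). With `f` the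
indicator of a set the Poincaré inequality turns this into `d(t)² ≤ R / (2 t)`; hence every mixing
time is at most a multiple of `R`. No coupling or monotonicity is needed, so small `δ` is not
special.

*Lower bound.* The eigenvector of the spectral gap `λ` gives `d(t) ≥ exp (-λ t) / 2`, so that the
mixing times at levels below `1 / 2` are at least a multiple of `1 / λ`, and `1 / λ ≤ R`.

*The gap.* It remains to prove that `λ` is at most a multiple of `1 / R` for a valley whose slopes
have comparable masses (`IsReversibleRates.gap_mul_left_le`, `gap_mul_right_le`). The Rayleigh
quotient of the function `f i`, the resistance between `i` and the bottom of the valley on one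
slope and zero on the other, is small: its energy is the resistance of the slope, and its variance
is at least the mass of the other slope times the square of the mean of `f`. The mean is of the
order of the resistance because `π` decreases towards the bottom
(`sum_mul_sum_one_div_le`).

So the mixing times, `1 / λ` and `R` are all of the same order `M n`. If `d n (B t n) → 0` then the
lower bound forces `t n / M n → ∞`, and then the upper bound gives `d n (A t n) → 0` for every
`A > 0`: there is no precutoff, and a fortiori no cutoff (`mixing_of_gap_mul_le`).
-/

namespace BirthDeath

/-! ### Reversible chains and the Dirichlet form -/

/-- `K` is a transition matrix which is reversible with respect to the positive probability
distribution `π`. -/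
structure IsReversible {Ω : Type*} [Fintype Ω] (K : Matrix Ω Ω ℝ) (π : Ω → ℝ) : Prop where
  nonneg : ∀ x y, 0 ≤ K x y
  row_sum : ∀ x, ∑ y, K x y = 1
  pos : ∀ x, 0 < π x
  sum_eq_one : ∑ x, π x = 1
  balance : ∀ x y, π x * K x y = π y * K y x

/-- The inner product of `L²(π)`, as a bilinear map. -/
noncomputable def wip {Ω : Type*} [Fintype Ω] (π : Ω → ℝ) :
    (Ω → ℝ) →ₗ[ℝ] (Ω → ℝ) →ₗ[ℝ] ℝ :=
  LinearMap.mk₂ ℝ (fun f g => ∑ x, π x * f x * g x)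
    (fun f g h => by simp only [Pi.add_apply, ← Finset.sum_add_distrib]; congr! 1; ring)
    (fun c f g => by simp only [Pi.smul_apply, smul_eq_mul, Finset.mul_sum]; congr! 1; ring)
    (fun f g h => by simp only [Pi.add_apply, ← Finset.sum_add_distrib]; congr! 1; ring)
    (fun c f g => by simp only [Pi.smul_apply, smul_eq_mul, Finset.mul_sum]; congr! 1; ring)

/-- The generator `I - K` acting on functions. -/
noncomputable def lap {Ω : Type*} [Fintype Ω] [DecidableEq Ω] (K : Matrix Ω Ω ℝ) :
    (Ω → ℝ) →ₗ[ℝ] (Ω → ℝ) :=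
  Matrix.toLin' (1 - K)

/-- The Dirichlet form `⟨f, (I - K) f⟩` in `L²(π)`. -/
noncomputable def dform {Ω : Type*} [Fintype Ω] [DecidableEq Ω] (K : Matrix Ω Ω ℝ) (π : Ω → ℝ)
    (f : Ω → ℝ) : ℝ :=
  wip π f (lap K f)

section General

variable {Ω : Type*} [Fintype Ω] [DecidableEq Ω] {K : Matrix Ω Ω ℝ} {π : Ω → ℝ}

omit [DecidableEq Ω] in
theorem wip_apply (f g : Ω → ℝ) : wip π f g = ∑ x, π x * f x * g x := rfl

omit [DecidableEq Ω] in
theorem wip_comm (f g : Ω → ℝ) : wip π f g = wip π g f := by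
  simp only [wip_apply]; congr! 1; ring

omit [DecidableEq Ω] in
theorem wip_one_left (f : Ω → ℝ) : wip π 1 f = ∑ x, π x * f x := by
  simp [wip_apply]

theorem lap_apply (f : Ω → ℝ) (x : Ω) : lap K f x = f x - ∑ y, K x y * f y := by
  simp [lap, Matrix.mulVec, dotProduct]

theorem wip_lap (f g : Ω → ℝ) :
    wip π f (lap K g) = ∑ x, π x * f x * g x - ∑ x, ∑ y, π x * K x y * (f x * g y) := by
  simp only [wip_apply, lap_apply, ← Finset.sum_sub_distrib]
  refine Finset.sum_congr rfl fun x _ => ?_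
  rw [mul_sub, Finset.mul_sum]
  congr! 2
  ring

theorem wip_sub_smul_lap (f : Ω → ℝ) (c : ℝ) :
    wip π (f - c • lap K f) (f - c • lap K f)
      = wip π f f - 2 * c * dform K π f + c ^ 2 * wip π (lap K f) (lap K f) := by
  have e := wip_comm (π := π) (lap K f) f
  simp only [dform, map_sub, map_smul, LinearMap.sub_apply, LinearMap.smul_apply, smul_eq_mul, e]
  ring

theorem lazyChain_mulVec (δ : ℝ) (f : Ω → ℝ) :
    (lazyChain δ K).mulVec f = f - (1 - δ) • lap K f := by
  simp only [lazyChain, lap, Matrix.toLin'_apply, Matrix.add_mulVec, Matrix.smul_mulVec,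
    Matrix.sub_mulVec, Matrix.one_mulVec]
  module

namespace IsReversible

variable (h : IsReversible K π)
include h

omit [DecidableEq Ω] in
theorem wip_self_nonneg (f : Ω → ℝ) : 0 ≤ wip π f f := by
  rw [wip_apply]
  refine Finset.sum_nonneg fun x _ => ?_
  rw [mul_assoc]
  exact mul_nonneg (h.pos x).le (mul_self_nonneg _)

omit [DecidableEq Ω] in
theorem wip_self_pos {f : Ω → ℝ} (hf : f ≠ 0) : 0 < wip π f f := by
  obtain ⟨x, hx⟩ := Function.ne_iff.1 hf
  rw [wip_apply]
  refine Finset.sum_pos' (fun x _ => ?_) ⟨x, Finset.mem_univ _, ?_⟩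
  · rw [mul_assoc]
    exact mul_nonneg (h.pos x).le (mul_self_nonneg _)
  · rw [mul_assoc]
    exact mul_pos (h.pos x) (mul_self_pos.2 hx)

theorem wip_lap_comm (f g : Ω → ℝ) : wip π f (lap K g) = wip π (lap K f) g := by
  rw [wip_comm (lap K f), wip_lap, wip_lap]
  congr 1
  · congr! 1; ring
  · rw [Finset.sum_comm]
    refine Finset.sum_congr rfl fun x _ => Finset.sum_congr rfl fun y _ => ?_
    rw [h.balance y x]; ring

theorem lap_one : lap K (1 : Ω → ℝ) = 0 := by
  ext x; simp [lap_apply, h.row_sum]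

theorem wip_one_lap (f : Ω → ℝ) : wip π 1 (lap K f) = 0 := by
  rw [h.wip_lap_comm, h.lap_one]; simp

omit [DecidableEq Ω] in
theorem sum_sum_left (f : Ω → ℝ) : ∑ x, ∑ y, π x * K x y * f x = ∑ x, π x * f x := by
  refine Finset.sum_congr rfl fun x _ => ?_
  rw [← Finset.sum_mul, ← Finset.mul_sum, h.row_sum, mul_one]

omit [DecidableEq Ω] in
theorem sum_sum_right (f : Ω → ℝ) : ∑ x, ∑ y, π x * K x y * f y = ∑ x, π x * f x := by
  rw [Finset.sum_comm, ← h.sum_sum_left]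
  refine Finset.sum_congr rfl fun x _ => Finset.sum_congr rfl fun y _ => ?_
  rw [h.balance y x]

theorem dform_eq (f : Ω → ℝ) :
    dform K π f = 1 / 2 * ∑ x, ∑ y, π x * K x y * (f x - f y) ^ 2 := by
  have e : ∀ x y, π x * K x y * (f x - f y) ^ 2 = π x * K x y * (f x * f x)
      + π x * K x y * (f y * f y) - 2 * (π x * K x y * (f x * f y)) := fun x y => by ring
  simp only [e, Finset.sum_sub_distrib, Finset.sum_add_distrib, ← Finset.mul_sum]
  rw [h.sum_sum_left (fun x => f x * f x), h.sum_sum_right (fun x => f x * f x), dform, wip_lap]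
  simp only [mul_assoc]
  ring

theorem dform_nonneg (f : Ω → ℝ) : 0 ≤ dform K π f := by
  rw [h.dform_eq]
  refine mul_nonneg (by norm_num) (Finset.sum_nonneg fun x _ => Finset.sum_nonneg fun y _ => ?_)
  exact mul_nonneg (mul_nonneg (h.pos x).le (h.nonneg x y)) (sq_nonneg _)

/-- The spectrum of `I - K` is bounded by `2`, because that of `K` is bounded below by `-1`. -/
theorem dform_le (f : Ω → ℝ) : dform K π f ≤ 2 * wip π f f := by
  have key : 2 * wip π f f - dform K π f
      = 1 / 2 * ∑ x, ∑ y, π x * K x y * (f x + f y) ^ 2 := by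
    have e : ∀ x y, π x * K x y * (f x + f y) ^ 2 = π x * K x y * (f x * f x)
        + π x * K x y * (f y * f y) + 2 * (π x * K x y * (f x * f y)) := fun x y => by ring
    simp only [e, Finset.sum_add_distrib, ← Finset.mul_sum]
    rw [h.sum_sum_left (fun x => f x * f x), h.sum_sum_right (fun x => f x * f x), dform,
      wip_lap, wip_apply]
    simp only [mul_assoc]
    ring
  have : 0 ≤ 1 / 2 * ∑ x, ∑ y, π x * K x y * (f x + f y) ^ 2 := by
    refine mul_nonneg (by norm_num) (Finset.sum_nonneg fun x _ => Finset.sum_nonneg fun y _ => ?_)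
    exact mul_nonneg (mul_nonneg (h.pos x).le (h.nonneg x y)) (sq_nonneg _)
  linarith

theorem dform_sub_smul_lap (f : Ω → ℝ) (c : ℝ) :
    dform K π (f - c • lap K f)
      = dform K π f - 2 * c * wip π (lap K f) (lap K f) + c ^ 2 * dform K π (lap K f) := by
  have e := h.wip_lap_comm f (lap K f)
  simp only [dform, map_sub, map_smul, LinearMap.sub_apply, LinearMap.smul_apply, smul_eq_mul, e]
  ring

/-- `(I - K)² ≤ 2 (I - K)`, from the positivity of the Dirichlet form at `f - (I - K) f / 2`. -/
theorem wip_lap_lap_le (f : Ω → ℝ) : wip π (lap K f) (lap K f) ≤ 2 * dform K π f := by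
  have h1 := h.dform_nonneg (f - (1 / 2 : ℝ) • lap K f)
  rw [h.dform_sub_smul_lap] at h1
  have h2 := h.dform_le (lap K f)
  linarith

theorem dform_sub_const (f : Ω → ℝ) (c : ℝ) : dform K π (f - fun _ => c) = dform K π f := by
  rw [h.dform_eq, h.dform_eq]; simp

/-! ### Decay of the Dirichlet form along the chain -/

/-- The energy dissipated in `m` steps of the lazy chain. In every step the squared norm drops by
at least `2 δ (1 - δ)` times the Dirichlet form, and the Dirichlet form itself does not increase. -/
theorem lazyChain_pow_decay {δ : ℝ} (h0 : 0 < δ) (h1 : δ < 1) (f : Ω → ℝ) (m : ℕ) :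
    wip π ((lazyChain δ K ^ m).mulVec f) ((lazyChain δ K ^ m).mulVec f)
      + 2 * δ * (1 - δ) * m * dform K π ((lazyChain δ K ^ m).mulVec f) ≤ wip π f f := by
  induction m with
  | zero => simp
  | succ m ih =>
    set g := (lazyChain δ K ^ m).mulVec f with hg
    have e : (lazyChain δ K ^ (m + 1)).mulVec f = g - (1 - δ) • lap K g := by
      rw [pow_succ', ← Matrix.mulVec_mulVec, lazyChain_mulVec]
    rw [e, wip_sub_smul_lap]
    have d1 := h.wip_lap_lap_le g
    have d2 := h.dform_le (lap K g)
    have d3 : dform K π (g - (1 - δ) • lap K g) ≤ dform K π g := by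
      rw [h.dform_sub_smul_lap]
      have := h.wip_self_nonneg (lap K g)
      have p1 : (1 - δ) ^ 2 * dform K π (lap K g)
          ≤ (1 - δ) ^ 2 * (2 * wip π (lap K g) (lap K g)) := by gcongr
      have p2 : 0 ≤ 2 * ((1 - δ) * δ) * wip π (lap K g) (lap K g) :=
        mul_nonneg (mul_nonneg zero_le_two (mul_nonneg (by linarith) h0.le)) this
      nlinarith
    have d4 : 2 * δ * (1 - δ) * ((m + 1 : ℕ) : ℝ) * dform K π (g - (1 - δ) • lap K g)
        ≤ 2 * δ * (1 - δ) * ((m + 1 : ℕ) : ℝ) * dform K π g := by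
      have : 0 ≤ 1 - δ := by linarith
      gcongr
    have d5 : (1 - δ) ^ 2 * wip π (lap K g) (lap K g) ≤ (1 - δ) ^ 2 * (2 * dform K π g) := by
      gcongr
    push_cast at d4 ⊢
    nlinarith

end IsReversible

theorem semigroup_zero : semigroup K 0 = 1 := by
  simp [semigroup]

section Derivative

attribute [local instance] Matrix.linftyOpNormedRing Matrix.linftyOpNormedAlgebra

theorem hasDerivAt_semigroup_mulVec (f : Ω → ℝ) (t : ℝ) :
    HasDerivAt (fun t => (semigroup K t).mulVec f) (-(lap K ((semigroup K t).mulVec f))) t ∧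
      HasDerivAt (fun t => (semigroup K t).mulVec f) ((semigroup K t).mulVec (-(lap K f))) t := by
  let ev : Matrix Ω Ω ℝ →ₗ[ℝ] (Ω → ℝ) :=
    { toFun := fun A => A.mulVec f
      map_add' := fun A B => Matrix.add_mulVec A B f
      map_smul' := fun c A => by simp [Matrix.smul_mulVec] }
  have hev := (ev.toContinuousLinearMap).hasFDerivAt (x := NormedSpace.exp (t • -(1 - K)))
  have h1 := hev.comp_hasDerivAt t (hasDerivAt_exp_smul_const' (𝕂 := ℝ) (-(1 - K)) t)
  have h2 := hev.comp_hasDerivAt t (hasDerivAt_exp_smul_const (𝕂 := ℝ) (-(1 - K)) t)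
  constructor
  · refine (h1.congr_deriv ?_).congr_of_eventuallyEq (Eventually.of_forall fun s => ?_)
    · change (-(1 - K) * _).mulVec f = _
      rw [← Matrix.mulVec_mulVec, Matrix.neg_mulVec, semigroup, smul_neg]
      rfl
    · simp only [semigroup, Function.comp_apply, smul_neg]
      rfl
  · refine (h2.congr_deriv ?_).congr_of_eventuallyEq (Eventually.of_forall fun s => ?_)
    · change (_ * -(1 - K)).mulVec f = _
      rw [← Matrix.mulVec_mulVec, Matrix.neg_mulVec, semigroup, smul_neg]
      rfl
    · simp only [semigroup, Function.comp_apply, smul_neg]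
      rfl

end Derivative

theorem semigroup_mulVec_of_eigenvector {f : Ω → ℝ} {l : ℝ} (hf : lap K f = l • f) (t : ℝ) :
    (semigroup K t).mulVec f = Real.exp (-(l * t)) • f := by
  -- the function `t ↦ exp (l t) H_t f` has derivative `exp (l t) H_t (l f - (I - K) f) = 0`
  have h2 : ∀ t, HasDerivAt (fun t => (semigroup K t).mulVec f)
      (-(l • (semigroup K t).mulVec f)) t := fun t => by
    have := (hasDerivAt_semigroup_mulVec (K := K) f t).2
    rwa [hf, Matrix.mulVec_neg, Matrix.mulVec_smul] at this
  have h3 : ∀ t, HasDerivAt (fun t => Real.exp (l * t) • (semigroup K t).mulVec f) 0 t := by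
    intro t
    refine ((((hasDerivAt_id t).const_mul l).exp).smul (h2 t)).congr_deriv ?_
    simp only [id_eq, mul_one]
    module
  have h4 := is_const_of_deriv_eq_zero (fun t => (h3 t).differentiableAt)
    (fun t => (h3 t).deriv) t 0
  simp only [mul_zero, Real.exp_zero, one_smul, semigroup_zero, Matrix.one_mulVec] at h4
  calc (semigroup K t).mulVec f
      = Real.exp (-(l * t)) • Real.exp (l * t) • (semigroup K t).mulVec f := by
        rw [smul_smul, ← Real.exp_add]; simp
    _ = _ := by rw [h4]

/-- The energy dissipated by the semigroup: the left-hand side is non-increasing in `t`, with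
derivative `-4 t ‖(I - K) H_t f‖²`. -/
theorem IsReversible.semigroup_decay (h : IsReversible K π) (f : Ω → ℝ) {t : ℝ} (ht : 0 ≤ t) :
    wip π ((semigroup K t).mulVec f) ((semigroup K t).mulVec f)
      + 2 * t * dform K π ((semigroup K t).mulVec f) ≤ wip π f f := by
  set g : ℝ → Ω → ℝ := fun t => (semigroup K t).mulVec f with hg
  have dg : ∀ t, HasDerivAt g (-(lap K (g t))) t := fun t => (hasDerivAt_semigroup_mulVec f t).1
  have dlg : ∀ t, HasDerivAt (fun t => lap K (g t)) (-(lap K (lap K (g t)))) t := fun t => by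
    have := (LinearMap.toContinuousLinearMap (lap K)).hasFDerivAt.comp_hasDerivAt t (dg t)
    simpa [Function.comp_def] using this
  have dwip : ∀ (u v : ℝ → Ω → ℝ) (u' v' : Ω → ℝ) t, HasDerivAt u u' t → HasDerivAt v v' t →
      HasDerivAt (fun t => wip π (u t) (v t)) (wip π u' (v t) + wip π (u t) v') t := by
    intro u v u' v' t hu hv
    simp only [wip_apply, ← Finset.sum_add_distrib]
    refine HasDerivAt.fun_sum fun x _ => ?_
    exact (((hasDerivAt_pi.1 hu x).const_mul (π x)).mul (hasDerivAt_pi.1 hv x))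
  have d1 : ∀ t, HasDerivAt (fun t => wip π (g t) (g t)) (-2 * dform K π (g t)) t := fun t => by
    refine (dwip g g _ _ t (dg t) (dg t)).congr_deriv ?_
    have := h.wip_lap_comm (g t) (g t)
    simp only [dform, map_neg, LinearMap.neg_apply]
    linarith
  have d2 : ∀ t, HasDerivAt (fun t => dform K π (g t)) (-2 * wip π (lap K (g t)) (lap K (g t))) t :=
    fun t => by
      refine (dwip g (fun t => lap K (g t)) _ _ t (dg t) (dlg t)).congr_deriv ?_
      have := h.wip_lap_comm (g t) (lap K (g t))
      simp only [map_neg, LinearMap.neg_apply]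
      linarith
  have d3 : ∀ t, HasDerivAt (fun t => wip π (g t) (g t) + 2 * t * dform K π (g t))
      (-4 * t * wip π (lap K (g t)) (lap K (g t))) t := fun t => by
    refine ((d1 t).add (((hasDerivAt_id t).const_mul 2).mul (d2 t))).congr_deriv ?_
    simp only [id_eq]; ring
  have anti : AntitoneOn (fun t => wip π (g t) (g t) + 2 * t * dform K π (g t)) (Set.Ici 0) := by
    refine antitoneOn_of_deriv_nonpos (convex_Ici 0)
      (fun t _ => (d3 t).continuousAt.continuousWithinAt)
      (fun t _ => (d3 t).differentiableAt.differentiableWithinAt) fun t ht => ?_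
    rw [interior_Ici, Set.mem_Ioi] at ht
    rw [(d3 t).deriv]
    have := mul_nonneg ht.le (h.wip_self_nonneg (lap K (g t)))
    linarith
  have := anti (Set.mem_Ici.2 le_rfl) (Set.mem_Ici.2 ht) ht
  simpa [hg, semigroup_zero] using this

end General

end BirthDeath
namespace BirthDeath

/-! ### Bounds on the total variation distance -/

section TotalVariation

variable {Ω : Type*} [Fintype Ω] {P : Matrix Ω Ω ℝ} {π : Ω → ℝ}

theorem le_tv (μ ν : Ω → ℝ) (A : Finset Ω) : ∑ x ∈ A, μ x - ∑ x ∈ A, ν x ≤ tv μ ν :=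
  le_ciSup (f := fun A : Finset Ω => ∑ x ∈ A, μ x - ∑ x ∈ A, ν x) (Set.finite_range _).bddAbove A

theorem tv_le_maxTV (x : Ω) : tv (P x) π ≤ maxTV P π :=
  le_ciSup (f := fun x => tv (P x) π) (Set.finite_range _).bddAbove x

theorem maxTV_nonneg [Nonempty Ω] : 0 ≤ maxTV P π := by
  obtain ⟨x⟩ := ‹Nonempty Ω›
  exact le_trans (by simpa using le_tv (P x) π ∅) (tv_le_maxTV x)

theorem sum_abs_sub_le_two_mul_tv {μ ν : Ω → ℝ} (h : ∑ x, μ x = ∑ x, ν x) :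
    ∑ x, |μ x - ν x| ≤ 2 * tv μ ν := by
  classical
  have h1 := le_tv μ ν (Finset.univ.filter fun x => ν x ≤ μ x)
  have h0 : ∑ x, (μ x - ν x) = 0 := by rw [Finset.sum_sub_distrib, h, sub_self]
  have h2 := Finset.sum_filter_add_sum_filter_not Finset.univ (fun x => ν x ≤ μ x)
    (fun x => |μ x - ν x|)
  have h3 := Finset.sum_filter_add_sum_filter_not Finset.univ (fun x => ν x ≤ μ x)
    (fun x => μ x - ν x)
  have h4 : ∑ x with ν x ≤ μ x, |μ x - ν x| = ∑ x with ν x ≤ μ x, (μ x - ν x) :=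
    Finset.sum_congr rfl fun x hx => abs_of_nonneg (by simpa using hx)
  have h5 : ∑ x with ¬ ν x ≤ μ x, |μ x - ν x| = -∑ x with ¬ ν x ≤ μ x, (μ x - ν x) := by
    rw [← Finset.sum_neg_distrib]
    refine Finset.sum_congr rfl fun x hx => abs_of_nonpos ?_
    have : μ x < ν x := by simpa using hx
    linarith
  rw [← Finset.sum_sub_distrib] at h1
  linarith

/-- An eigenvector of mean zero, tested at a point where its modulus is maximal, bounds the total
variation distance from below. -/
theorem abs_eigenvalue_le_two_mul_maxTV (hP : ∀ x, ∑ y, P x y = 1) (hπ : ∑ x, π x = 1)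
    {f : Ω → ℝ} {b : ℝ} (hf : P.mulVec f = b • f) (h0 : wip π 1 f = 0) (hne : f ≠ 0) :
    |b| ≤ 2 * maxTV P π := by
  obtain ⟨z, hz⟩ := Function.ne_iff.1 hne
  have : Nonempty Ω := ⟨z⟩
  obtain ⟨x, hx⟩ := Finite.exists_max fun x => |f x|
  have hpos : 0 < |f x| := (abs_pos.2 hz).trans_le (hx z)
  have e : b * f x = ∑ y, (P x y - π y) * f y := by
    have := congrFun hf x
    simp only [Matrix.mulVec, dotProduct, Pi.smul_apply, smul_eq_mul] at this
    rw [wip_one_left] at h0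
    simp only [sub_mul, Finset.sum_sub_distrib, h0, this, sub_zero]
  have : |b| * |f x| ≤ 2 * maxTV P π * |f x| := by
    rw [← abs_mul, e]
    calc |∑ y, (P x y - π y) * f y| ≤ ∑ y, |P x y - π y| * |f y| := by
          simpa only [abs_mul] using
            Finset.abs_sum_le_sum_abs (fun y => (P x y - π y) * f y) Finset.univ
      _ ≤ ∑ y, |P x y - π y| * |f x| :=
          Finset.sum_le_sum fun y _ => mul_le_mul_of_nonneg_left (hx y) (abs_nonneg _)
      _ = (∑ y, |P x y - π y|) * |f x| := by rw [Finset.sum_mul]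
      _ ≤ 2 * tv (P x) π * |f x| := by
          gcongr; exact sum_abs_sub_le_two_mul_tv (by rw [hP, hπ])
      _ ≤ 2 * maxTV P π * |f x| := by gcongr; exact tv_le_maxTV x
  exact le_of_mul_le_mul_right this hpos

variable [DecidableEq Ω] {K : Matrix Ω Ω ℝ}

/-- The deviation of `P 1_A` from its mean is controlled by its Dirichlet form. -/
theorem IsReversible.maxTV_le (h : IsReversible K π) [Nonempty Ω] {R s : ℝ} (hR0 : 0 ≤ R)
    (hs : 0 < s) (hR : ∀ g x, (g x - wip π 1 g) ^ 2 ≤ R * dform K π g)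
    (hmean : ∀ f, wip π 1 (P.mulVec f) = wip π 1 f)
    (hdecay : ∀ f, wip π (P.mulVec f) (P.mulVec f) + s * dform K π (P.mulVec f) ≤ wip π f f) :
    maxTV P π ≤ √(R / s) := by
  refine ciSup_le fun x => ciSup_le fun A => ?_
  set f : Ω → ℝ := fun y => if y ∈ A then 1 else 0 with hf
  have e1 : ∑ y ∈ A, P x y = (P.mulVec f) x := by
    simp [hf, Matrix.mulVec, dotProduct]
  have e2 : ∑ y ∈ A, π y = wip π 1 (P.mulVec f) := by
    rw [hmean, wip_one_left]; simp [hf]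
  have e3 : wip π f f ≤ 1 := by
    rw [wip_apply, ← h.sum_eq_one]
    refine Finset.sum_le_sum fun y _ => ?_
    have := (h.pos y).le
    by_cases hy : y ∈ A <;> simp [hf, hy, this]
  rw [e1, e2]
  refine Real.le_sqrt_of_sq_le ((hR _ x).trans ?_)
  have := h.wip_self_nonneg (P.mulVec f)
  rw [div_eq_mul_one_div]
  gcongr
  rw [le_div_iff₀ hs]
  linarith [hdecay f]

theorem IsReversible.distDisc_lazyChain_le (h : IsReversible K π) [Nonempty Ω] {R δ : ℝ}
    (hR0 : 0 ≤ R) (hR : ∀ g x, (g x - wip π 1 g) ^ 2 ≤ R * dform K π g) (h0 : 0 < δ) (h1 : δ < 1)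
    {m : ℕ} (hm : 0 < m) :
    distDisc (lazyChain δ K) π m ≤ √(R / (2 * δ * (1 - δ) * m)) := by
  have : 0 < 1 - δ := by linarith
  refine h.maxTV_le hR0 (by positivity) hR (fun f => ?_) fun f => h.lazyChain_pow_decay h0 h1 f m
  clear hm
  induction m with
  | zero => simp
  | succ m ih =>
    rw [pow_succ', ← Matrix.mulVec_mulVec, lazyChain_mulVec, map_sub, map_smul, h.wip_one_lap, ih]
    simp

theorem IsReversible.distCont_le (h : IsReversible K π) [Nonempty Ω] {R t : ℝ}
    (hR0 : 0 ≤ R) (hR : ∀ g x, (g x - wip π 1 g) ^ 2 ≤ R * dform K π g) (ht : 0 < t) :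
    distCont K π t ≤ √(R / (2 * t)) := by
  refine h.maxTV_le hR0 (by positivity) hR (fun f => ?_) fun f => h.semigroup_decay f ht.le
  have d : ∀ t, HasDerivAt (fun t => wip π 1 ((semigroup K t).mulVec f)) 0 t := fun t => by
    refine ((wip π 1).toContinuousLinearMap.hasFDerivAt.comp_hasDerivAt t
      (hasDerivAt_semigroup_mulVec (K := K) f t).1).congr_deriv ?_
    change wip π 1 (-_) = 0
    rw [map_neg, h.wip_one_lap, neg_zero]
  have := is_const_of_deriv_eq_zero (fun t => (d t).differentiableAt) (fun t => (d t).deriv) t 0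
  simpa [semigroup_zero] using this

theorem IsReversible.exp_le_two_mul_distCont (h : IsReversible K π) {f : Ω → ℝ} {l : ℝ}
    (hf : lap K f = l • f) (h0 : wip π 1 f = 0) (hne : f ≠ 0) (t : ℝ) :
    Real.exp (-(l * t)) ≤ 2 * distCont K π t := by
  have := abs_eigenvalue_le_two_mul_maxTV (P := semigroup K t) (fun x => ?_) h.sum_eq_one
    (semigroup_mulVec_of_eigenvector hf t) h0 hne
  · rwa [abs_of_pos (Real.exp_pos _)] at this
  · have e := semigroup_mulVec_of_eigenvector (K := K) (f := 1) (l := 0) (by simp [h.lap_one]) t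
    simpa [Matrix.mulVec, dotProduct] using congrFun e x

theorem lazyChain_pow_mulVec_of_eigenvector {f : Ω → ℝ} {l : ℝ} (hf : lap K f = l • f) (δ : ℝ)
    (m : ℕ) : (lazyChain δ K ^ m).mulVec f = (1 - (1 - δ) * l) ^ m • f := by
  induction m with
  | zero => simp
  | succ m ih =>
    rw [pow_succ', ← Matrix.mulVec_mulVec, ih, Matrix.mulVec_smul, lazyChain_mulVec, hf]
    module

theorem IsReversible.pow_le_two_mul_distDisc (h : IsReversible K π) {f : Ω → ℝ} {l : ℝ}
    (hf : lap K f = l • f) (h0 : wip π 1 f = 0) (hne : f ≠ 0) (δ : ℝ) (m : ℕ) :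
    (1 - (1 - δ) * l) ^ m ≤ 2 * distDisc (lazyChain δ K) π m := by
  refine (le_abs_self _).trans (abs_eigenvalue_le_two_mul_maxTV (P := lazyChain δ K ^ m)
    (fun x => ?_) h.sum_eq_one (lazyChain_pow_mulVec_of_eigenvector hf δ m) h0 hne)
  have e := lazyChain_pow_mulVec_of_eigenvector (K := K) (f := 1) (l := 0) (by simp [h.lap_one]) δ m
  simpa [Matrix.mulVec, dotProduct] using congrFun e x

end TotalVariation

/-! ### The spectral gap -/

section SpectralGap

variable {Ω : Type*} [Fintype Ω] [DecidableEq Ω] {K : Matrix Ω Ω ℝ} {π : Ω → ℝ}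

/-- An eigenvector of a non-zero eigenvalue has mean zero. -/
theorem IsReversible.wip_one_eq_zero (h : IsReversible K π) {f : Ω → ℝ} {l : ℝ} (hl : l ≠ 0)
    (hf : lap K f = l • f) : wip π 1 f = 0 := by
  have := h.wip_one_lap f
  rw [hf, map_smul, smul_eq_mul] at this
  exact (mul_eq_zero.1 this).resolve_left hl

/-- Variational characterization: the Rayleigh quotient attains its minimum over the non-zero
functions of mean zero, and a minimizer is an eigenvector. -/
theorem IsReversible.exists_eigenvector_of_rayleigh (h : IsReversible K π) [Nontrivial Ω] :
    ∃ (l : ℝ) (f : Ω → ℝ), f ≠ 0 ∧ wip π 1 f = 0 ∧ lap K f = l • f ∧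
      ∀ g, wip π 1 g = 0 → l * wip π g g ≤ dform K π g := by
  have cw : ∀ u v : (Ω → ℝ) → Ω → ℝ, Continuous u → Continuous v →
      Continuous fun f => wip π (u f) (v f) := fun u v hu hv => by
    simp only [wip_apply]; fun_prop
  have cl : Continuous (lap K) := (lap K).continuous_of_finiteDimensional
  let S : Set (Ω → ℝ) := {f | wip π 1 f = 0 ∧ wip π f f = 1}
  have scale : ∀ g, wip π 1 g = 0 → g ≠ 0 → (√(wip π g g))⁻¹ • g ∈ S := fun g hg hne => by
    have := h.wip_self_pos hne
    refine ⟨by simp [hg], ?_⟩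
    simp only [map_smul, LinearMap.smul_apply, smul_eq_mul]
    rw [← mul_assoc, ← mul_inv, Real.mul_self_sqrt this.le, inv_mul_cancel₀ this.ne']
  have hS : IsCompact S := by
    refine (isCompact_univ_pi fun x => isCompact_Icc (a := -√(1 / π x))
      (b := √(1 / π x))).of_isClosed_subset ?_ fun f hf => ?_
    · exact (isClosed_eq (cw _ _ continuous_const continuous_id) continuous_const).inter
        (isClosed_eq (cw _ _ continuous_id continuous_id) continuous_const)
    · intro x _
      rw [Set.mem_Icc, ← abs_le]
      refine Real.abs_le_sqrt ?_
      rw [le_div_iff₀ (h.pos x), ← hf.2, wip_apply]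
      refine le_trans (le_of_eq ?_) (Finset.single_le_sum
        (f := fun x => π x * f x * f x) (fun y _ => ?_) (Finset.mem_univ x))
      · ring
      · rw [mul_assoc]; exact mul_nonneg (h.pos y).le (mul_self_nonneg _)
  have hne : S.Nonempty := by
    obtain ⟨x, y, hxy⟩ := exists_pair_ne Ω
    refine ⟨_, scale (Pi.single x (π y) - Pi.single y (π x)) ?_ fun e => ?_⟩
    · simp only [map_sub, wip_one_left, Pi.single_apply, mul_ite, mul_zero, Finset.sum_ite_eq',
        Finset.mem_univ, if_true]
      ring
    · have := congrFun e x
      simp [hxy, (h.pos y).ne'] at this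
  obtain ⟨f, hf, hmin⟩ := hS.exists_isMinOn hne
    (cw _ _ continuous_id cl : Continuous fun f => wip π f (lap K f)).continuousOn
  set l := wip π f (lap K f) with hl
  have ray : ∀ g, wip π 1 g = 0 → l * wip π g g ≤ dform K π g := fun g hg => by
    by_cases hg0 : g = 0
    · simp [hg0, dform]
    · have := hmin (scale g hg hg0)
      have hp := h.wip_self_pos hg0
      simp only [Set.mem_ofPred_eq, map_smul, LinearMap.smul_apply, smul_eq_mul] at this
      rw [← mul_assoc, ← mul_inv, Real.mul_self_sqrt hp.le, ← div_eq_inv_mul,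
        le_div_iff₀ hp] at this
      exact this
  refine ⟨l, f, fun e => ?_, hf.1, ?_, ray⟩
  · have := hf.2; simp [e] at this
  -- the derivative of the Rayleigh quotient at `f` in the direction `u = (I - K) f - l f` vanishes
  set u := lap K f - l • f with hu
  have hu0 : wip π 1 u = 0 := by
    simp [hu, h.wip_one_lap, hf.1]
  have expand : ∀ s : ℝ, 0 ≤ s * (2 * wip π u u) + s ^ 2 * (dform K π u - l * wip π u u) := by
    intro s
    have r := ray (f + s • u) (by simp [hf.1, hu0])
    have s1 := h.wip_lap_comm f u
    have s2 := wip_comm (π := π) u f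
    have s3 := wip_comm (π := π) u (lap K f)
    have s4 : wip π u u = wip π (lap K f) u - l * wip π f u := by
      conv_lhs => enter [1]; rw [hu]
      simp
    have s5 := hf.2
    simp only [dform, map_add, map_smul, LinearMap.add_apply, LinearMap.smul_apply, smul_eq_mul,
      s1, s2, s3, s5, ← hl] at r
    rw [dform]
    linear_combination r - 2 * s * s4
  by_contra hne'
  have hpos : 0 < wip π u u := h.wip_self_pos fun e => hne' (sub_eq_zero.1 e)
  set c := dform K π u - l * wip π u u with hc
  have hc0 : 0 ≤ c := sub_nonneg.2 (ray u hu0)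
  have := expand (-(wip π u u / (c + 1)))
  have e : -(wip π u u / (c + 1)) * (2 * wip π u u) + (-(wip π u u / (c + 1))) ^ 2 * c
      = -(wip π u u ^ 2 / (c + 1) ^ 2 * (c + 2)) := by
    field_simp; ring
  rw [e] at this
  have : 0 < wip π u u ^ 2 / (c + 1) ^ 2 * (c + 2) := by positivity
  linarith

/-- The spectral gap is an eigenvalue, it is at least `1 / R` when `R` is a constant in the uniform
Poincaré inequality, and it is bounded by the Rayleigh quotients. -/
theorem IsReversible.spectralGap_spec (h : IsReversible K π) [Nontrivial Ω] {R : ℝ} (hR0 : 0 < R)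
    (hR : ∀ g x, (g x - wip π 1 g) ^ 2 ≤ R * dform K π g) :
    1 / R ≤ spectralGap K ∧ spectralGap K ≤ 2 ∧
      (∃ f, f ≠ 0 ∧ wip π 1 f = 0 ∧ lap K f = spectralGap K • f) ∧
      ∀ g, wip π 1 g = 0 → spectralGap K * wip π g g ≤ dform K π g := by
  let S : Set ℝ := {l : ℝ | l ≠ 0 ∧ Module.End.HasEigenvalue (Matrix.toLin' (1 - K)) l}
  have lower : ∀ l f, f ≠ 0 → wip π 1 f = 0 → lap K f = l • f → 1 / R ≤ l := fun l f hne h0 hf => by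
    have hp := h.wip_self_pos hne
    have e : dform K π f = l * wip π f f := by rw [dform, hf, map_smul, smul_eq_mul]
    have : wip π f f ≤ R * dform K π f := by
      have e2 : R * dform K π f = ∑ x, π x * (R * dform K π f) := by
        rw [← Finset.sum_mul, h.sum_eq_one, one_mul]
      rw [e2, wip_apply]
      refine Finset.sum_le_sum fun x _ => ?_
      have := hR f x
      rw [h0, sub_zero, sq] at this
      rw [mul_assoc]
      exact mul_le_mul_of_nonneg_left this (h.pos x).le
    rw [e] at this
    rw [div_le_iff₀ hR0]
    nlinarith
  have mem : ∀ l f, l ≠ 0 → f ≠ 0 → lap K f = l • f → l ∈ S := fun l f hl hne hf =>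
    ⟨hl, Module.End.hasEigenvalue_of_hasEigenvector ⟨Module.End.mem_eigenspace_iff.2 hf, hne⟩⟩
  have fin : S.Finite := (Module.End.finite_hasEigenvalue _).subset fun l hl => hl.2
  obtain ⟨l, f, hne, h0, hf, ray⟩ := h.exists_eigenvector_of_rayleigh
  have hl := lower l f hne h0 hf
  have hlS : l ∈ S := mem l f (ne_of_gt ((one_div_pos.2 hR0).trans_le hl)) hne hf
  have hmem : spectralGap K ∈ S := Set.Nonempty.csInf_mem ⟨l, hlS⟩ fin
  have hle : spectralGap K ≤ l := csInf_le fin.bddBelow hlS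
  obtain ⟨g, hg⟩ := hmem.2.exists_hasEigenvector
  have hg1 : lap K g = spectralGap K • g := hg.apply_eq_smul
  have hg0 := h.wip_one_eq_zero hmem.1 hg1
  refine ⟨lower _ g hg.2 hg0 hg1, ?_, ⟨g, hg.2, hg0, hg1⟩, fun u hu => ?_⟩
  · have := h.dform_le g
    rw [dform, hg1, map_smul, smul_eq_mul] at this
    exact le_of_mul_le_mul_right this (h.wip_self_pos hg.2)
  · exact (mul_le_mul_of_nonneg_right hle (h.wip_self_nonneg u)).trans (ray u hu)

end SpectralGap

end BirthDeath
namespace BirthDeath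

/-! ### Birth and death chains -/

/-- Birth, death and holding rates on `{0, ..., n}` such that all neighbours communicate, together
with a positive probability distribution `π` satisfying the detailed balance equations. -/
structure IsReversibleRates {n : ℕ} (p q r π : Fin (n + 1) → ℝ) : Prop where
  rates : IsRates p q r
  birth_pos : ∀ i : Fin n, 0 < p i.castSucc
  death_pos : ∀ i : Fin n, 0 < q i.succ
  pos : ∀ x, 0 < π x
  sum_eq_one : ∑ x, π x = 1
  balance : ∀ i : Fin n, π i.castSucc * p i.castSucc = π i.succ * q i.succ

section Rates

variable {n : ℕ} {p q r π : Fin (n + 1) → ℝ}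

theorem sum_sum_bdMatrix_mul (g : Fin (n + 1) → Fin (n + 1) → ℝ) :
    ∑ x, ∑ y, bdMatrix p q r x y * g x y
      = ∑ i : Fin n, p i.castSucc * g i.castSucc i.succ
        + ∑ i : Fin n, q i.succ * g i.succ i.castSucc + ∑ x, r x * g x x := by
  have e : ∀ x y, bdMatrix p q r x y * g x y = (if (y : ℕ) = x + 1 then p x * g x y else 0)
      + (if (y : ℕ) + 1 = x then q x * g x y else 0) + if y = x then r x * g x y else 0 := by
    intro x y
    unfold bdMatrix
    by_cases h1 : (y : ℕ) = x + 1
    · have h2 : ¬ (y : ℕ) + 1 = x := by omega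
      have h3 : ¬ y = x := by rw [Fin.ext_iff]; omega
      rw [if_pos h1, if_pos h1, if_neg h2, if_neg h3, add_zero, add_zero]
    · by_cases h2 : (y : ℕ) + 1 = x
      · have h3 : ¬ y = x := by rw [Fin.ext_iff]; omega
        simp [h1, h2, h3]
      · simp [h1, h2]
  simp only [e, Finset.sum_add_distrib]
  congr 1
  · congr 1
    · rw [Fin.sum_univ_castSucc, Finset.sum_eq_zero (s := Finset.univ)
        (f := fun y : Fin (n + 1) => if (y : ℕ) = (Fin.last n : ℕ) + 1 then _ else _), add_zero]
      · refine Finset.sum_congr rfl fun i _ => ?_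
        have : ∀ y : Fin (n + 1), ((y : ℕ) = (i.castSucc : ℕ) + 1) = (y = i.succ) := fun y => by
          simp [Fin.ext_iff]
        simp only [this, Finset.sum_ite_eq', Finset.mem_univ, if_true]
      · intro y _
        rw [if_neg]
        have := y.is_lt
        simp only [Fin.val_last]
        omega
    · rw [Finset.sum_comm, Fin.sum_univ_castSucc, Finset.sum_eq_zero (s := Finset.univ)
        (f := fun y : Fin (n + 1) => if (Fin.last n : ℕ) + 1 = y then _ else _), add_zero]
      · refine Finset.sum_congr rfl fun i _ => ?_
        have : ∀ y : Fin (n + 1), ((i.castSucc : ℕ) + 1 = (y : ℕ)) = (y = i.succ) := fun y => by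
          simp [Fin.ext_iff, eq_comm]
        simp only [this, Finset.sum_ite_eq', Finset.mem_univ, if_true]
      · intro y _
        rw [if_neg]
        have := y.is_lt
        simp only [Fin.val_last]
        omega
  · simp

theorem sum_bdMatrix (h : IsRates p q r) (x : Fin (n + 1)) : ∑ y, bdMatrix p q r x y = 1 := by
  have e := sum_sum_bdMatrix_mul (p := p) (q := q) (r := r) fun z _ => if z = x then 1 else 0
  have e1 := Fin.sum_univ_castSucc fun z => p z * if z = x then (1 : ℝ) else 0
  have e2 := Fin.sum_univ_succ fun z => q z * if z = x then (1 : ℝ) else 0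
  simp only [h.birth_last, h.death_zero, zero_mul, add_zero, zero_add] at e1 e2
  rw [← e1, ← e2] at e
  simp only [mul_ite, mul_one, mul_zero, Finset.sum_ite_eq', Finset.mem_univ, if_true] at e
  rw [Finset.sum_comm] at e
  simp only [Finset.sum_ite_eq', Finset.mem_univ, if_true] at e
  rw [e, h.sum_eq_one]

/-- Detailed balance holds for a stationary distribution of a birth and death chain, because the
flow across each edge vanishes in equilibrium. -/
theorem IsStationaryDist.balance (h : IsRates p q r) (hs : IsStationaryDist (bdMatrix p q r) π)
    (i : Fin n) : π i.castSucc * p i.castSucc = π i.succ * q i.succ := by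
  have e := sum_sum_bdMatrix_mul (p := p) (q := q) (r := r) fun x y =>
    π x * ((if y ≤ i.castSucc then 1 else 0) - if x ≤ i.castSucc then 1 else 0)
  have s1 : ∑ x, ∑ y, bdMatrix p q r x y * (π x * if y ≤ i.castSucc then 1 else 0)
      = ∑ y, π y * if y ≤ i.castSucc then 1 else 0 := by
    rw [Finset.sum_comm]
    refine Finset.sum_congr rfl fun y _ => ?_
    conv_rhs => rw [← hs.vecMul_eq]
    rw [Matrix.vecMul, dotProduct, Finset.sum_mul]
    refine Finset.sum_congr rfl fun x _ => ?_
    ring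
  have s2 : ∑ x, ∑ y, bdMatrix p q r x y * (π x * if x ≤ i.castSucc then 1 else 0)
      = ∑ y, π y * if y ≤ i.castSucc then 1 else 0 := by
    refine Finset.sum_congr rfl fun x _ => ?_
    rw [← Finset.sum_mul, sum_bdMatrix h, one_mul]
  simp only [mul_sub, Finset.sum_sub_distrib] at e
  rw [s1, s2] at e
  simp only [← Finset.sum_sub_distrib, ← mul_sub] at e
  have t1 : ∀ k : Fin n, ((if k.succ ≤ i.castSucc then (1 : ℝ) else 0)
      - if k.castSucc ≤ i.castSucc then 1 else 0) = if k = i then -1 else 0 := fun k => by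
    simp only [Fin.le_def, Fin.ext_iff, Fin.val_succ, Fin.val_castSucc]
    split_ifs <;> first | omega | norm_num
  have t2 : ∀ k : Fin n, ((if k.castSucc ≤ i.castSucc then (1 : ℝ) else 0)
      - if k.succ ≤ i.castSucc then 1 else 0) = if k = i then 1 else 0 := fun k => by
    simp only [Fin.le_def, Fin.ext_iff, Fin.val_succ, Fin.val_castSucc]
    split_ifs <;> first | omega | norm_num
  simp only [t1, t2, sub_self, mul_zero, Finset.sum_const_zero, add_zero, mul_ite, mul_one,
    Finset.sum_ite_eq', Finset.mem_univ, if_true] at e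
  linarith

theorem birth_pos_of_isIrreducible (h : IsRates p q r) (hi : (bdMatrix p q r).IsIrreducible)
    (i : Fin n) : 0 < p i.castSucc := by
  refine lt_of_le_of_ne (h.birth_nonneg _) fun h0 => ?_
  have key : ∀ k x y, x ≤ i.castSucc → i.castSucc < y → (bdMatrix p q r ^ k) x y = 0 := by
    intro k
    induction k with
    | zero => intro x y hx hy; rw [pow_zero, Matrix.one_apply_ne (hx.trans_lt hy).ne]
    | succ k ih =>
      intro x y hx hy
      rw [pow_succ, Matrix.mul_apply]
      refine Finset.sum_eq_zero fun z _ => ?_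
      rcases le_or_gt z i.castSucc with hz | hz
      · have : bdMatrix p q r z y = 0 := by
          have hzy := hz.trans_lt hy
          unfold bdMatrix
          rw [Fin.lt_def] at hy hzy
          rw [Fin.le_def] at hz
          split_ifs with c1 c2 c3
          · have : z = i.castSucc := by rw [Fin.ext_iff]; omega
            rw [this, ← h0]
          · omega
          · rw [Fin.ext_iff] at c3; omega
          · rfl
        rw [this, mul_zero]
      · rw [ih x z hx hz, zero_mul]
  obtain ⟨k, -, hk⟩ := (Matrix.isIrreducible_iff_exists_pow_pos hi.nonneg).1 hi i.castSucc i.succ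
  rw [key k _ _ le_rfl (Fin.castSucc_lt_succ)] at hk
  exact lt_irrefl _ hk

theorem IsStationaryDist.isReversibleRates (h : IsRates p q r)
    (hi : (bdMatrix p q r).IsIrreducible) (hs : IsStationaryDist (bdMatrix p q r) π) :
    IsReversibleRates p q r π := by
  have bal := hs.balance h
  have hp := birth_pos_of_isIrreducible h hi
  have hstep : ∀ k x, π x = 0 → ∀ y, (bdMatrix p q r ^ k) y x ≠ 0 → π y = 0 := by
    intro k x hx y hy
    have hinv : ∀ k, Matrix.vecMul π (bdMatrix p q r ^ k) = π := by
      intro k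
      induction k with
      | zero => simp
      | succ k ih => rw [pow_succ, ← Matrix.vecMul_vecMul, ih, hs.vecMul_eq]
    have e := congrFun (hinv k) x
    rw [hx, Matrix.vecMul, dotProduct, Finset.sum_eq_zero_iff_of_nonneg] at e
    · exact (mul_eq_zero.1 (e y (Finset.mem_univ _))).resolve_right hy
    · exact fun z _ => mul_nonneg (hs.nonneg z) (Matrix.pow_apply_nonneg hi.nonneg k z x)
  have hpos : ∀ x, 0 < π x := by
    intro x
    refine lt_of_le_of_ne (hs.nonneg x) fun h0 => ?_
    have := hs.sum_eq_one
    rw [Finset.sum_eq_zero fun y _ => ?_] at this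
    · exact zero_ne_one this
    · obtain ⟨k, -, hk⟩ := (Matrix.isIrreducible_iff_exists_pow_pos hi.nonneg).1 hi y x
      exact hstep k x h0.symm y hk.ne'
  refine ⟨h, hp, fun i => ?_, hpos, hs.sum_eq_one, bal⟩
  have := bal i ▸ mul_pos (hpos i.castSucc) (hp i)
  exact pos_of_mul_pos_right this (hpos _).le

namespace IsReversibleRates

variable (h : IsReversibleRates p q r π)
include h

theorem isReversible : IsReversible (bdMatrix p q r) π where
  nonneg x y := by
    unfold bdMatrix
    split_ifs
    exacts [h.rates.birth_nonneg x, h.rates.death_nonneg x, h.rates.hold_nonneg x, le_rfl]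
  row_sum := sum_bdMatrix h.rates
  pos := h.pos
  sum_eq_one := h.sum_eq_one
  balance := by
    have key : ∀ x y : Fin (n + 1), (y : ℕ) = x + 1 →
        π x * bdMatrix p q r x y = π y * bdMatrix p q r y x := by
      intro x y hxy
      have hx : (x : ℕ) < n := by have := y.is_lt; omega
      have b := h.balance ⟨x, hx⟩
      have e1 : Fin.castSucc ⟨x, hx⟩ = x := rfl
      have e2 : Fin.succ ⟨x, hx⟩ = y := Fin.ext hxy.symm
      rw [e1, e2] at b
      unfold bdMatrix
      rw [if_pos hxy, if_neg (by omega), if_pos hxy.symm, b]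
    intro x y
    by_cases h1 : (y : ℕ) = x + 1
    · exact key x y h1
    · by_cases h2 : (x : ℕ) = y + 1
      · exact (key y x h2).symm
      · by_cases h3 : x = y
        · rw [h3]
        · unfold bdMatrix
          rw [if_neg h1, if_neg (Ne.symm h2), if_neg (Ne.symm h3), if_neg h2, if_neg (Ne.symm h1),
            if_neg h3, mul_zero, mul_zero]

/-- The Dirichlet form is a sum over edges. -/
theorem dform_eq_sum (f : Fin (n + 1) → ℝ) :
    dform (bdMatrix p q r) π f
      = ∑ i : Fin n, π i.castSucc * p i.castSucc * (f i.succ - f i.castSucc) ^ 2 := by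
  have e := sum_sum_bdMatrix_mul (p := p) (q := q) (r := r) fun x y => π x * (f x - f y) ^ 2
  simp only [sub_self, ne_eq, OfNat.ofNat_ne_zero, not_false_eq_true, zero_pow, mul_zero,
    Finset.sum_const_zero, add_zero, ← Finset.sum_add_distrib] at e
  rw [h.isReversible.dform_eq]
  have e' : ∀ x y, π x * bdMatrix p q r x y * (f x - f y) ^ 2
      = bdMatrix p q r x y * (π x * (f x - f y) ^ 2) := fun x y => by ring
  simp only [e']
  rw [e, Finset.mul_sum]
  refine Finset.sum_congr rfl fun i _ => ?_
  linear_combination -(1 / 2) * (f i.succ - f i.castSucc) ^ 2 * h.balance i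

omit h in
theorem abs_sub_le_sum_abs (g : Fin (n + 1) → ℝ) (x y : Fin (n + 1)) :
    |g x - g y| ≤ ∑ i : Fin n, |g i.succ - g i.castSucc| := by
  wlog hxy : x ≤ y generalizing x y
  · rw [abs_sub_comm]; exact this y x (le_of_not_ge hxy)
  let G : ℕ → ℝ := fun k => g (Fin.ofNat (n + 1) k)
  have hG : ∀ z : Fin (n + 1), G z = g z := fun z => by
    simp only [G]; congr 1; ext; simp
  have h1 := dist_le_Ico_sum_dist G (m := x) (n := y) hxy
  rw [hG, hG, Real.dist_eq] at h1
  refine h1.trans ?_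
  have h2 : ∑ i ∈ Finset.Ico (x : ℕ) y, dist (G i) (G (i + 1))
      ≤ ∑ i ∈ Finset.range n, dist (G i) (G (i + 1)) := by
    refine Finset.sum_le_sum_of_subset_of_nonneg (fun i hi => ?_) fun i _ _ => dist_nonneg
    rw [Finset.mem_Ico] at hi
    rw [Finset.mem_range]
    have := y.is_lt
    omega
  refine h2.trans (le_of_eq ?_)
  rw [Finset.sum_range]
  refine Finset.sum_congr rfl fun i _ => ?_
  rw [dist_comm, Real.dist_eq]
  have e1 := hG i.castSucc
  have e2 := hG i.succ
  rw [Fin.val_castSucc] at e1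
  rw [Fin.val_succ] at e2
  rw [e1, e2]

/-- The uniform Poincaré inequality, whose constant is the effective resistance between the
endpoints. -/
theorem sq_sub_mean_le (g : Fin (n + 1) → ℝ) (x : Fin (n + 1)) :
    (g x - wip π 1 g) ^ 2
      ≤ (∑ i : Fin n, 1 / (π i.castSucc * p i.castSucc)) * dform (bdMatrix p q r) π g := by
  set D := ∑ i : Fin n, |g i.succ - g i.castSucc| with hD
  have h1 : |g x - wip π 1 g| ≤ D := by
    have e : g x - wip π 1 g = ∑ y, π y * (g x - g y) := by
      simp only [mul_sub, Finset.sum_sub_distrib, ← Finset.sum_mul, h.sum_eq_one, one_mul,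
        wip_one_left]
    rw [e]
    calc |∑ y, π y * (g x - g y)| ≤ ∑ y, |π y * (g x - g y)| := Finset.abs_sum_le_sum_abs _ _
      _ ≤ ∑ y, π y * D := by
          refine Finset.sum_le_sum fun y _ => ?_
          rw [abs_mul, abs_of_pos (h.pos y)]
          exact mul_le_mul_of_nonneg_left (abs_sub_le_sum_abs g x y) (h.pos y).le
      _ = D := by rw [← Finset.sum_mul, h.sum_eq_one, one_mul]
  have h2 : D ^ 2 ≤ (∑ i : Fin n, 1 / (π i.castSucc * p i.castSucc))
      * dform (bdMatrix p q r) π g := by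
    rw [h.dform_eq_sum, hD]
    refine Finset.sum_sq_le_sum_mul_sum_of_sq_le_mul _ (fun i _ => ?_) (fun i _ => ?_)
      fun i _ => ?_
    · have := mul_pos (h.pos i.castSucc) (h.birth_pos i); positivity
    · have := mul_pos (h.pos i.castSucc) (h.birth_pos i); positivity
    · have := (mul_pos (h.pos i.castSucc) (h.birth_pos i)).ne'
      rw [sq_abs, mul_left_comm, ← mul_assoc, mul_one_div_cancel this, one_mul]
  calc (g x - wip π 1 g) ^ 2 = |g x - wip π 1 g| ^ 2 := (sq_abs _).symm
    _ ≤ D ^ 2 := by gcongr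
    _ ≤ _ := h2

end IsReversibleRates

end Rates

end BirthDeath
namespace BirthDeath

/-! ### Valleys: the spectral gap against the resistance -/

/-- For a decreasing positive sequence, the pairs `i < k` carry a fixed proportion of the double
sum `∑ i, ∑ k, π i / π k`: in each pair the term with `i < k` is at least the one with `k < i`, and
the diagonal terms are all equal to `1`. -/
theorem sum_mul_sum_one_div_le {α : Type*} [LinearOrder α] {s : Finset α} {π : α → ℝ}
    (hpos : ∀ i ∈ s, 0 < π i) (anti : AntitoneOn π s) (hs : 2 ≤ s.card) :
    (∑ i ∈ s, π i) * ∑ k ∈ s, 1 / π k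
      ≤ 4 * ∑ i ∈ s, ∑ k ∈ s, if i < k then π i / π k else 0 := by
  set X := ∑ i ∈ s, ∑ k ∈ s, if i < k then π i / π k else 0 with hX
  set N := ∑ i ∈ s, ∑ k ∈ s, if i < k then (1 : ℝ) else 0 with hN
  have one_le : ∀ i ∈ s, ∀ k ∈ s, i < k → 1 ≤ π i / π k := fun i hi k hk hik => by
    rw [one_le_div (hpos k hk)]
    exact anti hi hk hik.le
  have hD : ∀ i ∈ s, ∑ k ∈ s, (if i = k then (1 : ℝ) else 0) = 1 := fun i hi => by
    rw [Finset.sum_ite_eq, if_pos hi]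
  have hNX : N ≤ X := by
    refine Finset.sum_le_sum fun i hi => Finset.sum_le_sum fun k hk => ?_
    split_ifs with hik
    · exact one_le i hi k hk hik
    · exact le_rfl
  have hN' : ∑ i ∈ s, ∑ k ∈ s, (if k < i then (1 : ℝ) else 0) = N := by
    rw [Finset.sum_comm]
  have count : (s.card : ℝ) * s.card = N + N + s.card := by
    have : (s.card : ℝ) * s.card = ∑ i ∈ s, ∑ k ∈ s,
        ((if i < k then (1 : ℝ) else 0) + (if k < i then 1 else 0) + if i = k then 1 else 0) := by
      rw [Finset.sum_congr rfl fun i _ => Finset.sum_congr rfl fun k _ => ?_]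
      rotate_left
      · exact 1
      · rcases lt_trichotomy i k with h | h | h
        · rw [if_pos h, if_neg h.asymm, if_neg h.ne]; norm_num
        · rw [if_neg h.not_lt, if_neg h.not_gt, if_pos h]; norm_num
        · rw [if_neg h.asymm, if_pos h, if_neg h.ne']; norm_num
      · simp
    rw [this]
    simp only [Finset.sum_add_distrib]
    rw [hN', Finset.sum_congr rfl hD]
    simp [hN]
  have hcard : (2 : ℝ) ≤ s.card := by exact_mod_cast hs
  have hc : (s.card : ℝ) ≤ 2 * X := by nlinarith
  have upper : (∑ i ∈ s, π i) * ∑ k ∈ s, 1 / π k ≤ X + X + s.card := by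
    have e : ∑ i ∈ s, ∑ k ∈ s, (if k < i then π k / π i else 0) = X := by
      rw [Finset.sum_comm]
    rw [Finset.sum_mul_sum]
    calc ∑ i ∈ s, ∑ k ∈ s, π i * (1 / π k)
        ≤ ∑ i ∈ s, ∑ k ∈ s, ((if i < k then π i / π k else 0) + (if k < i then π k / π i else 0)
          + if i = k then 1 else 0) := by
          refine Finset.sum_le_sum fun i hi => Finset.sum_le_sum fun k hk => ?_
          rw [mul_one_div]
          rcases lt_trichotomy i k with h | h | h
          · rw [if_pos h, if_neg h.asymm, if_neg h.ne, add_zero, add_zero]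
          · rw [if_neg h.not_lt, if_neg h.not_gt, if_pos h, h, div_self (hpos k hk).ne']
            norm_num
          · rw [if_neg h.asymm, if_pos h, if_neg h.ne', add_zero, zero_add]
            refine le_trans ?_ (one_le k hk i hi h)
            rw [div_le_one (hpos k hk)]
            exact anti hk hi h.le
      _ = X + X + s.card := by
          simp only [Finset.sum_add_distrib]
          rw [e, Finset.sum_congr rfl hD]
          simp [hX]
  linarith

theorem sum_mul_sum_one_div_le_of_monotoneOn {α : Type*} [LinearOrder α] {s : Finset α} {π : α → ℝ}
    (hpos : ∀ i ∈ s, 0 < π i) (mono : MonotoneOn π s) (hs : 2 ≤ s.card) :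
    (∑ i ∈ s, π i) * ∑ k ∈ s, 1 / π k
      ≤ 4 * ∑ i ∈ s, ∑ k ∈ s, if k < i then π i / π k else 0 :=
  sum_mul_sum_one_div_le (α := αᵒᵈ) (s := s) (π := π) hpos (fun _ hx _ hy hxy => mono hy hx hxy) hs

/-- A test function which vanishes on a set of mass at least `c` and has mean at least `b` has
variance at least `c b²`. -/
theorem IsReversible.gap_mul_le_dform {Ω : Type*} [Fintype Ω] [DecidableEq Ω] {K : Matrix Ω Ω ℝ}
    {π : Ω → ℝ} (h : IsReversible K π) {l : ℝ} (hl : 0 ≤ l)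
    (ray : ∀ g, wip π 1 g = 0 → l * wip π g g ≤ dform K π g) {f : Ω → ℝ} {s : Finset Ω} {b c : ℝ}
    (hf : ∀ x ∈ s, f x = 0) (hc0 : 0 ≤ c) (hc : c ≤ ∑ x ∈ s, π x) (hb0 : 0 ≤ b)
    (hb : b ≤ wip π 1 f) : l * (c * b ^ 2) ≤ dform K π f := by
  have e1 : wip π 1 (fun _ => wip π 1 f) = wip π 1 f := by
    rw [wip_one_left (fun _ => _), ← Finset.sum_mul, h.sum_eq_one, one_mul]
  have r := ray (f - fun _ => wip π 1 f) (by rw [map_sub, e1, sub_self])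
  rw [h.dform_sub_const] at r
  refine le_trans (mul_le_mul_of_nonneg_left ?_ hl) r
  rw [wip_apply]
  have hs0 : 0 ≤ ∑ x ∈ s, π x := hc0.trans hc
  calc c * b ^ 2 ≤ (∑ x ∈ s, π x) * (wip π 1 f) ^ 2 := by gcongr
    _ = ∑ x ∈ s, π x * (f x - wip π 1 f) * (f x - wip π 1 f) := by
        rw [Finset.sum_mul]
        refine Finset.sum_congr rfl fun x hx => ?_
        rw [hf x hx]; ring
    _ ≤ _ := by
        refine Finset.sum_le_sum_of_subset_of_nonneg (Finset.subset_univ _) fun x _ _ => ?_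
        rw [mul_assoc]; exact mul_nonneg (h.pos x).le (mul_self_nonneg _)

theorem DistValley.antitoneOn {n : ℕ} {π : Fin (n + 1) → ℝ} {j : Fin (n + 1)}
    (hv : DistValley π j) : AntitoneOn π (Finset.Iic j : Finset (Fin (n + 1))) := by
  have key : ∀ x : Fin (n + 1), x ≤ j → ∀ y, y ≤ x → π x ≤ π y := by
    intro x
    induction x using Fin.induction with
    | zero => intro _ y hy; rw [Fin.le_zero_iff.1 hy]
    | succ i ih =>
      intro hx y hy
      have hlt : i.castSucc < j := (Fin.castSucc_lt_succ).trans_le hx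
      rcases hy.eq_or_lt with rfl | hy
      · exact le_rfl
      · exact ((hv i).1 hlt).trans (ih hlt.le y (Fin.le_castSucc_iff.2 hy))
  intro x _ y hy hxy
  exact key y (by simpa using hy) x hxy

theorem DistValley.monotoneOn {n : ℕ} {π : Fin (n + 1) → ℝ} {j : Fin (n + 1)}
    (hv : DistValley π j) : MonotoneOn π (Finset.Ici j : Finset (Fin (n + 1))) := by
  have key : ∀ y x : Fin (n + 1), j ≤ x → x ≤ y → π x ≤ π y := by
    intro y
    induction y using Fin.induction with
    | zero => intro x _ hx; rw [Fin.le_zero_iff.1 hx]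
    | succ i ih =>
      intro x hx hy
      rcases hy.eq_or_lt with rfl | hy
      · exact le_rfl
      · have hy' := Fin.le_castSucc_iff.2 hy
        exact (ih x hx hy').trans ((hv i).2 (hx.trans hy'))
  intro x hx y _ hxy
  exact key y x (by simpa using hx) hxy

namespace IsReversibleRates

variable {n : ℕ} {p q r π : Fin (n + 1) → ℝ} (h : IsReversibleRates p q r π)
include h

/-- The gap is bounded by the inverse resistance of the left slope of a valley. The test function
is the resistance between a state and the bottom `j` of the valley. -/
theorem gap_mul_left_le {l : ℝ} (hl : 0 ≤ l)
    (ray : ∀ g, wip π 1 g = 0 → l * wip π g g ≤ dform (bdMatrix p q r) π g)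
    {j : Fin (n + 1)} (hj : 0 < j) (hv : DistValley π j) {κ c : ℝ} (hκ : 0 < κ) (hc : 0 < c)
    (hq1 : ∀ i, 0 < i → i ≤ j → q i ≤ κ * q j) (hq2 : ∀ i, 0 < i → i ≤ j → q j ≤ κ * q i)
    (hL : c ≤ ∑ i ∈ Finset.Iic j, π i) (hR : c ≤ ∑ i ∈ Finset.Ici j, π i) :
    l * (1 / q j * ∑ i ∈ Finset.Iic j, 1 / π i) ≤ 16 * κ ^ 3 / c ^ 3 := by
  have qpos : ∀ i, 0 < i → 0 < q i := fun i hi => by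
    obtain ⟨k, rfl⟩ := Fin.exists_succ_eq.2 hi.ne'
    exact h.death_pos k
  have hqj := qpos j hj
  set W := ∑ i ∈ Finset.Iic j, 1 / π i with hW
  have hWpos : 0 < W := Finset.sum_pos (fun i _ => one_div_pos.2 (h.pos i)) ⟨j, by simp⟩
  let f : Fin (n + 1) → ℝ := fun i => ∑ k ∈ Finset.Ioc i j, 1 / (π k * q k)
  have anti := hv.antitoneOn
  have hcard : 2 ≤ (Finset.Iic j).card := by
    rw [Fin.card_Iic]
    have : 0 < (j : ℕ) := hj
    omega
  have cheb := sum_mul_sum_one_div_le (fun i _ => h.pos i) anti hcard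
  have mean : c / (4 * κ) * (1 / q j * W) ≤ wip π 1 f := by
    have e1 : ∑ i ∈ Finset.Iic j, ∑ k ∈ Finset.Iic j, (if i < k then π i / π k else 0)
        ≤ κ * q j * wip π 1 f := by
      rw [wip_one_left, Finset.mul_sum]
      refine (Finset.sum_le_sum fun i _ => ?_).trans (Finset.sum_le_sum_of_subset_of_nonneg
        (Finset.subset_univ (Finset.Iic j)) fun i _ _ => ?_)
      · rw [← Finset.sum_filter, Finset.mul_sum, Finset.mul_sum]
        have e : (Finset.Iic j).filter (fun k => i < k) = Finset.Ioc i j := by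
          ext k; simp [and_comm]
        rw [e]
        refine Finset.sum_le_sum fun k hk => ?_
        rw [Finset.mem_Ioc] at hk
        have hk0 : 0 < k := (Fin.zero_le i).trans_lt hk.1
        have h1 := qpos k hk0
        have h2 := h.pos k
        have h3 := h.pos i
        have h4 := hq1 k hk0 hk.2
        have : π i / π k = q k * (π i * (1 / (π k * q k))) := by field_simp
        rw [this]
        gcongr
      · refine mul_nonneg (by positivity) (mul_nonneg (h.pos i).le
          (Finset.sum_nonneg fun k hk => ?_))
        rw [Finset.mem_Ioc] at hk
        have h1 := qpos k ((Fin.zero_le i).trans_lt hk.1)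
        have h2 := h.pos k
        positivity
    have e2 : c * W ≤ 4 * (κ * q j * wip π 1 f) :=
      (mul_le_mul_of_nonneg_right hL hWpos.le).trans (cheb.trans (by linarith))
    rw [div_mul_eq_mul_div, div_le_iff₀ (by positivity), one_div, ← mul_assoc, mul_comm c,
      mul_assoc, inv_mul_le_iff₀ hqj]
    linarith
  have energy : dform (bdMatrix p q r) π f ≤ κ * (1 / q j * W) := by
    rw [h.dform_eq_sum, hW, Finset.mul_sum, Finset.mul_sum, ← Finset.univ_inter (Finset.Iic j),
      ← Finset.sum_ite_mem, Fin.sum_univ_succ]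
    have h0 : (0 : ℝ) ≤ if (0 : Fin (n + 1)) ∈ Finset.Iic j then κ * (1 / q j * (1 / π 0))
        else 0 := by
      have := h.pos 0
      split_ifs <;> positivity
    refine le_trans (Finset.sum_le_sum fun i _ => ?_) (le_add_of_nonneg_left h0)
    have h1 := qpos i.succ (Fin.succ_pos i)
    have h2 := h.pos i.succ
    rw [h.balance]
    by_cases hi : i.succ ≤ j
    · have e : f i.castSucc = f i.succ + 1 / (π i.succ * q i.succ) := by
        have : Finset.Ioc i.castSucc j = insert i.succ (Finset.Ioc i.succ j) := by
          ext k
          simp only [Finset.mem_Ioc, Finset.mem_insert, Fin.ext_iff, Fin.lt_def, Fin.le_def,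
            Fin.val_castSucc, Fin.val_succ] at hi ⊢
          omega
        simp only [f]
        rw [this, Finset.sum_insert (by simp), add_comm]
      rw [e, if_pos (by simpa using hi)]
      have h3 := hq2 i.succ (Fin.succ_pos i) hi
      have : π i.succ * q i.succ * (f i.succ - (f i.succ + 1 / (π i.succ * q i.succ))) ^ 2
          = 1 / π i.succ * (1 / q i.succ) := by field_simp; ring
      rw [this]
      have h4 : 1 / q i.succ ≤ κ * (1 / q j) := by
        rw [mul_one_div, div_le_div_iff₀ h1 hqj, one_mul]; exact h3
      have h5 : 0 ≤ 1 / π i.succ := by positivity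
      nlinarith
    · rw [if_neg (by simpa using hi)]
      have e1 : f i.succ = 0 := by
        simp only [f]; rw [Finset.Ioc_eq_empty, Finset.sum_empty]
        exact fun hlt => hi hlt.le
      have e2 : f i.castSucc = 0 := by
        simp only [f]; rw [Finset.Ioc_eq_empty, Finset.sum_empty]
        simpa [Fin.castSucc_lt_iff_succ_le] using hi
      rw [e1, e2]; simp
  have hM : 0 < 1 / q j * W := by positivity
  have key := h.isReversible.gap_mul_le_dform hl ray (s := Finset.Ici j) (f := f)
    (fun x hx => by
      simp only [f]; rw [Finset.Ioc_eq_empty, Finset.sum_empty]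
      simpa using hx) hc.le hR (by positivity) mean
  have := key.trans energy
  set M := 1 / q j * W with hM'
  rw [le_div_iff₀ (by positivity)]
  have e : l * (c * (c / (4 * κ) * M) ^ 2) = l * M * c ^ 3 * (M / (16 * κ ^ 2)) := by
    field_simp; ring
  rw [e] at this
  have e' : κ * M = 16 * κ ^ 3 * (M / (16 * κ ^ 2)) := by field_simp
  rw [e'] at this
  exact le_of_mul_le_mul_right this (by positivity)

/-- The counterpart of `gap_mul_left_le` for the right slope of a valley. -/
theorem gap_mul_right_le {l : ℝ} (hl : 0 ≤ l)
    (ray : ∀ g, wip π 1 g = 0 → l * wip π g g ≤ dform (bdMatrix p q r) π g)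
    {j : Fin (n + 1)} (hj : j < Fin.last n) (hv : DistValley π j) {κ c : ℝ} (hκ : 0 < κ)
    (hc : 0 < c)
    (hp1 : ∀ i, j ≤ i → i < Fin.last n → p i ≤ κ * p j)
    (hp2 : ∀ i, j ≤ i → i < Fin.last n → p j ≤ κ * p i)
    (hL : c ≤ ∑ i ∈ Finset.Iic j, π i) (hR : c ≤ ∑ i ∈ Finset.Ici j, π i) :
    l * (1 / p j * ∑ i ∈ Finset.Ici j, 1 / π i) ≤ 16 * κ ^ 3 / c ^ 3 := by
  have ppos : ∀ i, i < Fin.last n → 0 < p i := fun i hi => by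
    obtain ⟨k, rfl⟩ := Fin.exists_castSucc_eq.2 hi.ne
    exact h.birth_pos k
  have hpj := ppos j hj
  set W := ∑ i ∈ Finset.Ici j, 1 / π i with hW
  have hWpos : 0 < W := Finset.sum_pos (fun i _ => one_div_pos.2 (h.pos i)) ⟨j, by simp⟩
  let f : Fin (n + 1) → ℝ := fun i => ∑ k ∈ Finset.Ico j i, 1 / (π k * p k)
  have mono := hv.monotoneOn
  have hcard : 2 ≤ (Finset.Ici j).card := by
    rw [Fin.card_Ici]
    have : (j : ℕ) < n := hj
    omega
  have cheb := sum_mul_sum_one_div_le_of_monotoneOn (fun i _ => h.pos i) mono hcard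
  have mean : c / (4 * κ) * (1 / p j * W) ≤ wip π 1 f := by
    have e1 : ∑ i ∈ Finset.Ici j, ∑ k ∈ Finset.Ici j, (if k < i then π i / π k else 0)
        ≤ κ * p j * wip π 1 f := by
      rw [wip_one_left, Finset.mul_sum]
      refine (Finset.sum_le_sum fun i _ => ?_).trans (Finset.sum_le_sum_of_subset_of_nonneg
        (Finset.subset_univ (Finset.Ici j)) fun i _ _ => ?_)
      · rw [← Finset.sum_filter, Finset.mul_sum, Finset.mul_sum]
        have e : (Finset.Ici j).filter (fun k => k < i) = Finset.Ico j i := by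
          ext k; simp
        rw [e]
        refine Finset.sum_le_sum fun k hk => ?_
        rw [Finset.mem_Ico] at hk
        have hk0 : k < Fin.last n := hk.2.trans_le (Fin.le_last i)
        have h1 := ppos k hk0
        have h2 := h.pos k
        have h3 := h.pos i
        have h4 := hp1 k hk.1 hk0
        have : π i / π k = p k * (π i * (1 / (π k * p k))) := by field_simp
        rw [this]
        gcongr
      · refine mul_nonneg (by positivity) (mul_nonneg (h.pos i).le
          (Finset.sum_nonneg fun k hk => ?_))
        rw [Finset.mem_Ico] at hk
        have h1 := ppos k (hk.2.trans_le (Fin.le_last i))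
        have h2 := h.pos k
        positivity
    have e2 : c * W ≤ 4 * (κ * p j * wip π 1 f) :=
      (mul_le_mul_of_nonneg_right hR hWpos.le).trans
        (cheb.trans (by linarith))
    rw [div_mul_eq_mul_div, div_le_iff₀ (by positivity), one_div, ← mul_assoc, mul_comm c,
      mul_assoc, inv_mul_le_iff₀ hpj]
    linarith
  have energy : dform (bdMatrix p q r) π f ≤ κ * (1 / p j * W) := by
    rw [h.dform_eq_sum, hW, Finset.mul_sum, Finset.mul_sum, ← Finset.univ_inter (Finset.Ici j),
      ← Finset.sum_ite_mem, Fin.sum_univ_castSucc]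
    have h0 : (0 : ℝ) ≤ if Fin.last n ∈ Finset.Ici j then κ * (1 / p j * (1 / π (Fin.last n)))
        else 0 := by
      have := h.pos (Fin.last n)
      split_ifs <;> positivity
    refine le_trans (Finset.sum_le_sum fun i _ => ?_) (le_add_of_nonneg_right h0)
    have h1 := ppos i.castSucc (Fin.castSucc_lt_last i)
    have h2 := h.pos i.castSucc
    by_cases hi : j ≤ i.castSucc
    · have e : f i.succ = f i.castSucc + 1 / (π i.castSucc * p i.castSucc) := by
        have : Finset.Ico j i.succ = insert i.castSucc (Finset.Ico j i.castSucc) := by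
          ext k
          simp only [Finset.mem_Ico, Finset.mem_insert, Fin.ext_iff, Fin.lt_def, Fin.le_def,
            Fin.val_castSucc, Fin.val_succ] at hi ⊢
          omega
        simp only [f]
        rw [this, Finset.sum_insert (by simp), add_comm]
      rw [e, if_pos (by simpa using hi)]
      have h3 := hp2 i.castSucc hi (Fin.castSucc_lt_last i)
      have : π i.castSucc * p i.castSucc
          * (f i.castSucc + 1 / (π i.castSucc * p i.castSucc) - f i.castSucc) ^ 2
          = 1 / π i.castSucc * (1 / p i.castSucc) := by field_simp; ring
      rw [this]
      have h4 : 1 / p i.castSucc ≤ κ * (1 / p j) := by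
        rw [mul_one_div, div_le_div_iff₀ h1 hpj, one_mul]; exact h3
      have h5 : 0 ≤ 1 / π i.castSucc := by positivity
      nlinarith
    · rw [if_neg (by simpa using hi)]
      have e1 : f i.castSucc = 0 := by
        simp only [f]; rw [Finset.Ico_eq_empty, Finset.sum_empty]
        exact fun hlt => hi hlt.le
      have e2 : f i.succ = 0 := by
        simp only [f]; rw [Finset.Ico_eq_empty, Finset.sum_empty]
        exact fun hlt => hi (Fin.le_castSucc_iff.2 hlt)
      rw [e1, e2]; simp
  have hM : 0 < 1 / p j * W := by positivity
  have key := h.isReversible.gap_mul_le_dform hl ray (s := Finset.Iic j) (f := f)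
    (fun x hx => by
      simp only [f]; rw [Finset.Ico_eq_empty, Finset.sum_empty]
      simpa using hx) hc.le hL (by positivity) mean
  have := key.trans energy
  set M := 1 / p j * W with hM'
  rw [le_div_iff₀ (by positivity)]
  have e : l * (c * (c / (4 * κ) * M) ^ 2) = l * M * c ^ 3 * (M / (16 * κ ^ 2)) := by
    field_simp; ring
  rw [e] at this
  have e' : κ * M = 16 * κ ^ 3 * (M / (16 * κ ^ 2)) := by field_simp
  rw [e'] at this
  exact le_of_mul_le_mul_right this (by positivity)

/-- The resistance between the endpoints is bounded by the sum of the two quantities attached to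
the slopes. -/
theorem sum_resistance_le {j : Fin (n + 1)} (hj0 : 0 < j) (hj : j < Fin.last n) {κ : ℝ} (hκ : 0 < κ)
    (hq2 : ∀ i, 0 < i → i ≤ j → q j ≤ κ * q i)
    (hp2 : ∀ i, j ≤ i → i < Fin.last n → p j ≤ κ * p i) :
    ∑ i : Fin n, 1 / (π i.castSucc * p i.castSucc)
      ≤ κ * (1 / q j * ∑ i ∈ Finset.Iic j, 1 / π i)
        + κ * (1 / p j * ∑ i ∈ Finset.Ici j, 1 / π i) := by
  have hqj : 0 < q j := by
    obtain ⟨k, rfl⟩ := Fin.exists_succ_eq.2 hj0.ne'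
    exact h.death_pos k
  have hpj : 0 < p j := by
    obtain ⟨k, rfl⟩ := Fin.exists_castSucc_eq.2 hj.ne
    exact h.birth_pos k
  have eL : ∑ i : Fin n, (if i.succ ≤ j then κ * (1 / q j * (1 / π i.succ)) else 0)
      ≤ κ * (1 / q j * ∑ i ∈ Finset.Iic j, 1 / π i) := by
    rw [Finset.mul_sum, Finset.mul_sum, ← Finset.univ_inter (Finset.Iic j),
      ← Finset.sum_ite_mem, Fin.sum_univ_succ]
    simp only [Finset.mem_Iic]
    refine le_add_of_nonneg_left ?_
    have := h.pos 0
    split_ifs <;> positivity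
  have eR : ∑ i : Fin n, (if j ≤ i.castSucc then κ * (1 / p j * (1 / π i.castSucc)) else 0)
      ≤ κ * (1 / p j * ∑ i ∈ Finset.Ici j, 1 / π i) := by
    rw [Finset.mul_sum, Finset.mul_sum, ← Finset.univ_inter (Finset.Ici j),
      ← Finset.sum_ite_mem, Fin.sum_univ_castSucc]
    simp only [Finset.mem_Ici]
    refine le_add_of_nonneg_right ?_
    have := h.pos (Fin.last n)
    split_ifs <;> positivity
  refine le_trans ?_ (add_le_add eL eR)
  rw [← Finset.sum_add_distrib]
  refine Finset.sum_le_sum fun i _ => ?_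
  rcases le_or_gt j i.castSucc with hi | hi
  · have h1 := h.birth_pos i
    have h2 := h.pos i.castSucc
    rw [if_neg (not_le.2 (Fin.le_castSucc_iff.1 hi)), if_pos hi, zero_add]
    have h3 := hp2 i.castSucc hi (Fin.castSucc_lt_last i)
    rw [← div_div, ← mul_assoc, mul_one_div κ, mul_one_div, div_div, div_div,
      div_le_div_iff₀ (by positivity) (by positivity)]
    nlinarith
  · have h1 := h.death_pos i
    have h2 := h.pos i.succ
    have hi' := Fin.castSucc_lt_iff_succ_le.1 hi
    rw [if_neg (not_le.2 hi), if_pos hi', add_zero, h.balance]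
    have h3 := hq2 i.succ (Fin.succ_pos i) hi'
    rw [← div_div, ← mul_assoc, mul_one_div κ, mul_one_div, div_div, div_div,
      div_le_div_iff₀ (by positivity) (by positivity)]
    nlinarith

/-- The larger of the quantities attached to the slopes tends to infinity with the number of
states. -/
theorem le_max_slopes {j : Fin (n + 1)} (hj0 : 0 < j) (hj : j < Fin.last n) :
    ((n : ℝ) + 1) / 2 ≤ max (1 / q j * ∑ i ∈ Finset.Iic j, 1 / π i)
      (1 / p j * ∑ i ∈ Finset.Ici j, 1 / π i) := by
  have hqj : 0 < q j := by
    obtain ⟨k, rfl⟩ := Fin.exists_succ_eq.2 hj0.ne'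
    exact h.death_pos k
  have hpj : 0 < p j := by
    obtain ⟨k, rfl⟩ := Fin.exists_castSucc_eq.2 hj.ne
    exact h.birth_pos k
  have hs := h.rates.sum_eq_one j
  have hr := h.rates.hold_nonneg j
  have hw : ∀ i, 0 ≤ 1 / π i := fun i => (one_div_pos.2 (h.pos i)).le
  have hw1 : ∀ i, 1 ≤ 1 / π i := fun i => by
    rw [one_le_div (h.pos i), ← h.sum_eq_one]
    exact Finset.single_le_sum (fun k _ => (h.pos k).le) (Finset.mem_univ i)
  have m1 : ∑ i ∈ Finset.Iic j, 1 / π i ≤ 1 / q j * ∑ i ∈ Finset.Iic j, 1 / π i :=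
    le_mul_of_one_le_left (Finset.sum_nonneg fun i _ => hw i) (by rw [one_le_div hqj]; linarith)
  have m2 : ∑ i ∈ Finset.Ici j, 1 / π i ≤ 1 / p j * ∑ i ∈ Finset.Ici j, 1 / π i :=
    le_mul_of_one_le_left (Finset.sum_nonneg fun i _ => hw i) (by rw [one_le_div hpj]; linarith)
  have total : ((n : ℝ) + 1) ≤ ∑ i ∈ Finset.Iic j, 1 / π i + ∑ i ∈ Finset.Ici j, 1 / π i := by
    calc ((n : ℝ) + 1) = ∑ i : Fin (n + 1), (1 : ℝ) := by simp
      _ ≤ ∑ i, 1 / π i := Finset.sum_le_sum fun i _ => hw1 i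
      _ = ∑ i ∈ Finset.Iic j ∪ Finset.Ici j, 1 / π i := by
          congr 1; ext i; simp [le_total]
      _ ≤ _ := by
          rw [← Finset.sum_union_inter]
          exact le_add_of_nonneg_right (Finset.sum_nonneg fun i _ => hw i)
  have := le_max_left (1 / q j * ∑ i ∈ Finset.Iic j, 1 / π i)
    (1 / p j * ∑ i ∈ Finset.Ici j, 1 / π i)
  have := le_max_right (1 / q j * ∑ i ∈ Finset.Iic j, 1 / π i)
    (1 / p j * ∑ i ∈ Finset.Ici j, 1 / π i)
  linarith

end IsReversibleRates

end BirthDeath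
namespace BirthDeath

/-! ### Families: mixing times and the absence of a precutoff -/

theorem isTheta_of_le_of_le {f g : ℕ → ℝ} {a b : ℝ} (ha : 0 < a)
    (h : ∀ᶠ n in atTop, 0 ≤ g n ∧ a * g n ≤ f n ∧ f n ≤ b * g n) : f =Θ[atTop] g := by
  constructor
  · refine IsBigO.of_bound b ?_
    filter_upwards [h] with n ⟨h0, h1, h2⟩
    rw [Real.norm_of_nonneg h0, Real.norm_of_nonneg ((mul_nonneg ha.le h0).trans h1)]
    exact h2
  · refine IsBigO.of_bound a⁻¹ ?_
    filter_upwards [h] with n ⟨h0, h1, h2⟩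
    rw [Real.norm_of_nonneg h0, Real.norm_of_nonneg ((mul_nonneg ha.le h0).trans h1)]
    rwa [inv_mul_eq_div, le_div_iff₀ ha, mul_comm]

theorem HasCutoffCont.hasPrecutoffCont {d : ℕ → ℝ → ℝ} (h : HasCutoffCont d) :
    HasPrecutoffCont d := by
  obtain ⟨t, ht, h⟩ := h
  have h2 := h (1 / 2) (by norm_num) (by norm_num)
  exact ⟨t, ht, 1 - 1 / 2, 1 + 1 / 2, by norm_num, by norm_num, h2.1, by
    rw [h2.2.liminf_eq]; exact one_pos⟩

theorem HasCutoffDisc.hasPrecutoffDisc {d : ℕ → ℕ → ℝ} (h : HasCutoffDisc d) :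
    HasPrecutoffDisc d := by
  obtain ⟨t, ht, h⟩ := h
  have h2 := h (1 / 2) (by norm_num) (by norm_num)
  exact ⟨t, ht, 1 - 1 / 2, 1 + 1 / 2, by norm_num, by norm_num, h2.1, by
    rw [h2.2.liminf_eq]; exact one_pos⟩

section Sequences

variable {M l : ℕ → ℝ} {C : ℝ}

theorem tendsto_sqrt_div_zero {u : ℕ → ℝ} (h : Tendsto (fun n => u n / M n) atTop atTop) :
    Tendsto (fun n => √(C * M n / u n)) atTop (𝓝 0) := by
  have h1 : Tendsto (fun n => C * (u n / M n)⁻¹) atTop (𝓝 0) := by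
    simpa using h.inv_tendsto_atTop.const_mul C
  have h2 := h1.sqrt
  rw [Real.sqrt_zero] at h2
  refine h2.congr fun n => ?_
  rw [inv_div, mul_div_assoc]

/-- If `d` is bounded below by an exponential of rate `l ≤ C / M` then `d n (t n) → 0` forces
`t` to be much larger than `M`. -/
theorem tendsto_div_of_exp_le (hC : 0 < C) (hM : Tendsto M atTop atTop)
    (hl : ∀ᶠ n in atTop, l n * M n ≤ C) {t e : ℕ → ℝ} (ht : ∀ n, 0 ≤ t n)
    (he : Tendsto e atTop (𝓝 0)) (hlo : ∀ᶠ n in atTop, Real.exp (-(l n * t n)) ≤ e n) :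
    Tendsto (fun n => t n / M n) atTop atTop := by
  have h1 : Tendsto (fun n => Real.exp (-(l n * t n))) atTop (𝓝 0) :=
    tendsto_of_tendsto_of_tendsto_of_le_of_le' tendsto_const_nhds he
      (Eventually.of_forall fun n => (Real.exp_pos _).le) hlo
  rw [Real.tendsto_exp_comp_nhds_zero, tendsto_neg_atBot_iff] at h1
  refine tendsto_atTop_mono' _ ?_ (h1.atTop_mul_const (inv_pos.2 hC))
  filter_upwards [hl, hM.eventually_gt_atTop 0] with n h2 h3
  rw [← div_eq_mul_inv, div_le_div_iff₀ hC h3]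
  have := mul_le_mul_of_nonneg_right h2 (ht n)
  linarith

theorem not_hasPrecutoffCont {d : ℕ → ℝ → ℝ} (hC : 0 < C) (hM : Tendsto M atTop atTop)
    (hl : ∀ᶠ n in atTop, l n * M n ≤ C)
    (hup : ∀ᶠ n in atTop, ∀ t, 0 < t → d n t ≤ √(C * M n / (2 * t)))
    (hlo : ∀ᶠ n in atTop, ∀ t, Real.exp (-(l n * t)) ≤ 2 * d n t) : ¬ HasPrecutoffCont d := by
  rintro ⟨t, ht, A, B, hA, hAB, hB0, hlim⟩
  have hB : 0 < B := hA.trans hAB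
  have h1 : Tendsto (fun n => B * t n / M n) atTop atTop :=
    tendsto_div_of_exp_le hC hM hl (fun n => (mul_pos hB (ht n)).le)
      (by simpa using hB0.const_mul 2) (hlo.mono fun n h => h _)
  have h2 : Tendsto (fun n => 2 * (A * t n) / M n) atTop atTop := by
    refine (h1.const_mul_atTop (show 0 < 2 * A / B by positivity)).congr fun n => ?_
    field_simp
  have h3 : Tendsto (fun n => d n (A * t n)) atTop (𝓝 0) := by
    refine tendsto_of_tendsto_of_tendsto_of_le_of_le' tendsto_const_nhds
      (tendsto_sqrt_div_zero (C := C) h2) ?_ (hup.mono fun n h => h _ (mul_pos hA (ht n)))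
    filter_upwards [hlo] with n h
    have := (Real.exp_pos _).trans_le (h (A * t n))
    linarith
  rw [h3.liminf_eq] at hlim
  exact lt_irrefl _ hlim

theorem exp_neg_two_mul_le_pow {a : ℝ} (h0 : 0 ≤ a) (h1 : a ≤ 1 / 2) (m : ℕ) :
    Real.exp (-(2 * a * m)) ≤ (1 - a) ^ m := by
  have key : Real.exp (-(2 * a)) ≤ 1 - a := by
    rw [Real.exp_neg, inv_le_comm₀ (Real.exp_pos _) (by linarith)]
    refine le_trans ?_ (Real.add_one_le_exp (2 * a))
    rw [inv_eq_one_div, div_le_iff₀ (by linarith)]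
    nlinarith
  calc Real.exp (-(2 * a * m)) = Real.exp (-(2 * a)) ^ m := by
        rw [← Real.exp_nat_mul]; congr 1; ring
    _ ≤ _ := by gcongr

/-- In discrete time `l` stands for `1` minus an eigenvalue of the chain. Rounding does not matter
because `M` tends to infinity. -/
theorem not_hasPrecutoffDisc {d : ℕ → ℕ → ℝ} (hC : 0 < C) (hM : Tendsto M atTop atTop)
    (hl : ∀ᶠ n in atTop, 0 ≤ l n ∧ l n * M n ≤ C) (hd : ∀ᶠ n in atTop, ∀ m, 0 ≤ d n m)
    (hup : ∀ᶠ n in atTop, ∀ m : ℕ, 0 < m → d n m ≤ √(C * M n / m))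
    (hlo : ∀ᶠ n in atTop, ∀ m, (1 - l n) ^ m ≤ 2 * d n m) : ¬ HasPrecutoffDisc d := by
  rintro ⟨t, ht, A, B, hA, hAB, hB0, hlim⟩
  have hB : 0 < B := hA.trans hAB
  have h1 : Tendsto (fun n => (⌈B * t n⌉₊ : ℝ) / M n) atTop atTop := by
    refine tendsto_div_of_exp_le (C := 2 * C) (l := fun n => 2 * l n) (by positivity) hM ?_
      (fun n => Nat.cast_nonneg _) (e := fun n => 2 * d n ⌈B * t n⌉₊)
      (by simpa using hB0.const_mul 2) ?_
    · filter_upwards [hl] with n h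
      linarith [h.2]
    · filter_upwards [hl, hlo, hM.eventually_ge_atTop (2 * C), hM.eventually_gt_atTop 0]
        with n h h' h2 h3
      refine (exp_neg_two_mul_le_pow h.1 ?_ _).trans (h' _)
      by_contra! hcon
      nlinarith [h.2]
  have h2 : Tendsto (fun n => (⌊A * t n⌋₊ : ℝ) / M n) atTop atTop := by
    have h4 := tendsto_atTop_add_const_right atTop (-(A / B + 1))
      (h1.const_mul_atTop (div_pos hA hB))
    refine tendsto_atTop_mono' _ ?_ h4
    filter_upwards [hM.eventually_ge_atTop 1] with n hn
    have f1 := Nat.lt_floor_add_one (A * t n)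
    have f2 := Nat.ceil_lt_add_one (mul_pos hB (ht n)).le
    have hMn : 0 < M n := by linarith
    rw [← sub_eq_add_neg, sub_le_iff_le_add, ← mul_div_assoc, div_le_iff₀ hMn, add_mul,
      div_mul_cancel₀ _ hMn.ne']
    have f3 : A / B * (⌈B * t n⌉₊ : ℝ) ≤ A / B * (B * t n + 1) := by gcongr
    have f4 : A / B * (B * t n + 1) = A * t n + A / B := by field_simp
    have f5 : A / B + 1 ≤ (A / B + 1) * M n := le_mul_of_one_le_right (by positivity) hn
    linarith
  have h3 : Tendsto (fun n => d n ⌊A * t n⌋₊) atTop (𝓝 0) := by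
    refine tendsto_of_tendsto_of_tendsto_of_le_of_le' tendsto_const_nhds
      (tendsto_sqrt_div_zero (C := C) h2) (hd.mono fun n h => h _) ?_
    filter_upwards [hup, h2.eventually_gt_atTop 0, hM.eventually_gt_atTop 0] with n h h' h''
    refine h _ ?_
    have := (div_pos_iff_of_pos_right h'').1 h'
    exact_mod_cast this
  rw [h3.liminf_eq] at hlim
  exact lt_irrefl _ hlim

theorem isTheta_sInf_cont {d : ℕ → ℝ → ℝ} (hC : 0 < C) (hM : Tendsto M atTop atTop)
    (hl : ∀ᶠ n in atTop, l n * M n ≤ C)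
    (hup : ∀ᶠ n in atTop, ∀ t, 0 < t → d n t ≤ √(C * M n / (2 * t)))
    (hlo : ∀ᶠ n in atTop, ∀ t, Real.exp (-(l n * t)) ≤ 2 * d n t) {ε : ℝ} (hε : 0 < ε)
    (hε2 : ε < 1 / 2) : (fun n => sInf {t : ℝ | 0 ≤ t ∧ d n t ≤ ε}) =Θ[atTop] M := by
  refine isTheta_of_le_of_le (a := (1 - 2 * ε) / C) (b := C / (2 * ε ^ 2))
    (div_pos (by linarith) hC) ?_
  filter_upwards [hl, hup, hlo, hM.eventually_gt_atTop 0] with n h1 h2 h3 h4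
  have mem : C / (2 * ε ^ 2) * M n ∈ {t : ℝ | 0 ≤ t ∧ d n t ≤ ε} := by
    refine ⟨by positivity, (h2 _ (by positivity)).trans (le_of_eq ?_)⟩
    rw [show C * M n / (2 * (C / (2 * ε ^ 2) * M n)) = ε ^ 2 by field_simp, Real.sqrt_sq hε.le]
  refine ⟨h4.le, le_csInf ⟨_, mem⟩ fun t ht => ?_, csInf_le ⟨0, fun t ht => ht.1⟩ mem⟩
  have h5 := h3 t
  have h6 := Real.add_one_le_exp (-(l n * t))
  have h7 : 1 - 2 * ε ≤ l n * t := by linarith [ht.2]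
  rw [div_mul_eq_mul_div, div_le_iff₀ hC]
  have h8 := mul_le_mul_of_nonneg_right h7 h4.le
  have h9 := mul_le_mul_of_nonneg_right h1 ht.1
  linarith

theorem isTheta_sInf_disc {d : ℕ → ℕ → ℝ} (hC : 0 < C) (hM : Tendsto M atTop atTop)
    (hl : ∀ᶠ n in atTop, l n ≤ 2 ∧ l n * M n ≤ C)
    (hup : ∀ᶠ n in atTop, ∀ m : ℕ, 0 < m → d n m ≤ √(C * M n / m))
    (hlo : ∀ᶠ n in atTop, ∀ m, (1 - l n) ^ m ≤ 2 * d n m) {ε : ℝ} (hε : 0 < ε)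
    (hε2 : ε < 1 / 2) : (fun n => ((sInf {m : ℕ | d n m ≤ ε} : ℕ) : ℝ)) =Θ[atTop] M := by
  refine isTheta_of_le_of_le (a := (1 - 2 * ε) / C) (b := C / ε ^ 2 + 1)
    (div_pos (by linarith) hC) ?_
  filter_upwards [hl, hup, hlo, hM.eventually_ge_atTop 1] with n h1 h2 h3 h4
  have hMn : 0 < M n := by linarith
  have mem : ⌈C / ε ^ 2 * M n⌉₊ ∈ {m : ℕ | d n m ≤ ε} := by
    have hpos : 0 < C / ε ^ 2 * M n := by positivity
    refine (h2 _ (Nat.ceil_pos.2 hpos)).trans ?_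
    rw [Real.sqrt_le_left hε.le]
    have := Nat.le_ceil (C / ε ^ 2 * M n)
    rw [div_le_iff₀ (hpos.trans_le this)]
    calc C * M n = ε ^ 2 * (C / ε ^ 2 * M n) := by field_simp
      _ ≤ _ := by gcongr
  refine ⟨hMn.le, ?_, ?_⟩
  · have hin : d n (sInf {m : ℕ | d n m ≤ ε}) ≤ ε := Nat.sInf_mem ⟨_, mem⟩
    set m := sInf {m : ℕ | d n m ≤ ε}
    have h5 := h3 m
    have h6 := one_add_mul_le_pow (a := -l n) (by linarith [h1.1]) m
    rw [← sub_eq_add_neg] at h6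
    have h7 : 1 - 2 * ε ≤ l n * m := by linarith
    rw [div_mul_eq_mul_div, div_le_iff₀ hC]
    have h8 := mul_le_mul_of_nonneg_right h7 hMn.le
    have h9 := mul_le_mul_of_nonneg_right h1.2 (Nat.cast_nonneg (α := ℝ) m)
    linarith
  · calc ((sInf {m : ℕ | d n m ≤ ε} : ℕ) : ℝ) ≤ (⌈C / ε ^ 2 * M n⌉₊ : ℝ) := by
          exact_mod_cast Nat.sInf_le mem
      _ ≤ C / ε ^ 2 * M n + 1 := (Nat.ceil_lt_add_one (by positivity)).le
      _ ≤ (C / ε ^ 2 + 1) * M n := by linarith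

end Sequences

/-- If, up to constants, `M n` bounds the uniform Poincaré constant from above and the relaxation
time from below, then both of them and all mixing times are of order `M n`, so that there is no
precutoff. -/
theorem mixing_of_gap_mul_le {Ω : ℕ → Type*} [∀ n, Fintype (Ω n)] [∀ n, DecidableEq (Ω n)]
    {K : ∀ n, Matrix (Ω n) (Ω n) ℝ} {π : ∀ n, Ω n → ℝ} {M : ℕ → ℝ} {C : ℝ} (hC : 0 < C)
    (hM : Tendsto M atTop atTop)
    (h : ∀ᶠ n in atTop, Nontrivial (Ω n) ∧ IsReversible (K n) (π n) ∧
      (∀ g x, (g x - wip (π n) 1 g) ^ 2 ≤ C * M n * dform (K n) (π n) g) ∧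
      spectralGap (K n) * M n ≤ C) :
    ¬ HasPrecutoffCont (fun n => distCont (K n) (π n)) ∧
    (∀ δ : ℝ, 0 < δ → δ < 1 →
      ¬ HasPrecutoffDisc (fun n => distDisc (lazyChain δ (K n)) (π n))) ∧
    (∀ ε δ : ℝ, 0 < ε → ε < 1 / 2 → 0 < δ → δ < 1 →
      ((fun n => mixCont (K n) (π n) ε) =Θ[atTop] M) ∧
      ((fun n => (mixDisc (lazyChain δ (K n)) (π n) ε : ℝ)) =Θ[atTop] M) ∧
      ((fun n => 1 / spectralGap (K n)) =Θ[atTop] M)) := by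
  have bounds : ∀ᶠ n in atTop,
      (1 / (C * M n) ≤ spectralGap (K n) ∧ spectralGap (K n) ≤ 2 ∧ spectralGap (K n) * M n ≤ C) ∧
      (∀ t, 0 < t → distCont (K n) (π n) t ≤ √(C * M n / (2 * t))) ∧
      (∀ t, Real.exp (-(spectralGap (K n) * t)) ≤ 2 * distCont (K n) (π n) t) ∧
      (∀ δ, 0 < δ → δ < 1 → ∀ m : ℕ, 0 < m →
        distDisc (lazyChain δ (K n)) (π n) m ≤ √(C * M n / (2 * δ * (1 - δ) * m))) ∧
      (∀ δ, ∀ m : ℕ, (1 - (1 - δ) * spectralGap (K n)) ^ m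
        ≤ 2 * distDisc (lazyChain δ (K n)) (π n) m) ∧
      ∀ δ, ∀ m : ℕ, 0 ≤ distDisc (lazyChain δ (K n)) (π n) m := by
    filter_upwards [h, hM.eventually_gt_atTop 0] with n ⟨_, hr, hR, hg⟩ hMn
    have hR0 : 0 < C * M n := mul_pos hC hMn
    obtain ⟨g1, g2, ⟨f, hne, h0, hf⟩, -⟩ := hr.spectralGap_spec hR0 hR
    exact ⟨⟨g1, g2, hg⟩, fun t ht => hr.distCont_le hR0.le hR ht,
      fun t => hr.exp_le_two_mul_distCont hf h0 hne t,
      fun δ h0 h1 m hm => hr.distDisc_lazyChain_le hR0.le hR h0 h1 hm,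
      fun δ m => hr.pow_le_two_mul_distDisc hf h0 hne δ m, fun δ m => maxTV_nonneg⟩
  have gap_nonneg : ∀ᶠ n in atTop, 0 < spectralGap (K n) := by
    filter_upwards [bounds, hM.eventually_gt_atTop 0] with n hn hMn
    exact (one_div_pos.2 (mul_pos hC hMn)).trans_le hn.1.1
  -- the constant for the lazy chains has to absorb both `C` and `C / (2 δ (1 - δ))`
  have discUp : ∀ δ : ℝ, 0 < δ → δ < 1 → ∀ᶠ n in atTop, ∀ m : ℕ, 0 < m →
      distDisc (lazyChain δ (K n)) (π n) m ≤ √((C + C / (2 * δ * (1 - δ))) * M n / m) := by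
    intro δ h0 h1
    filter_upwards [bounds, hM.eventually_gt_atTop 0] with n hn hMn m hm
    refine (hn.2.2.2.1 δ h0 h1 m hm).trans (Real.sqrt_le_sqrt ?_)
    have h2 : 0 < 1 - δ := by linarith
    rw [← div_div, mul_div_right_comm C]
    gcongr
    linarith
  have discGap : ∀ δ : ℝ, 0 < δ → δ < 1 → ∀ᶠ n in atTop, 0 ≤ (1 - δ) * spectralGap (K n) ∧
      (1 - δ) * spectralGap (K n) ≤ 2 ∧
      (1 - δ) * spectralGap (K n) * M n ≤ C + C / (2 * δ * (1 - δ)) := by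
    intro δ h0 h1
    have h2 : 0 < 1 - δ := by linarith
    have h3 : 0 ≤ C / (2 * δ * (1 - δ)) := by positivity
    filter_upwards [bounds, gap_nonneg, hM.eventually_gt_atTop 0] with n hn hg hMn
    have h4 := mul_pos hg hMn
    refine ⟨by positivity, ?_, ?_⟩
    · nlinarith [hn.1.2.1]
    · nlinarith [hn.1.2.2]
  have discC : ∀ δ : ℝ, 0 < δ → δ < 1 → 0 < C + C / (2 * δ * (1 - δ)) := by
    intro δ h0 h1
    have h2 : 0 < 1 - δ := by linarith
    positivity
  refine ⟨not_hasPrecutoffCont hC hM (bounds.mono fun n hn => hn.1.2.2)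
    (bounds.mono fun n hn => hn.2.1) (bounds.mono fun n hn => hn.2.2.1), fun δ h0 h1 => ?_,
    fun ε δ hε hε2 h0 h1 => ⟨?_, ?_, ?_⟩⟩
  · exact not_hasPrecutoffDisc (discC δ h0 h1) hM
      ((discGap δ h0 h1).mono fun n hn => ⟨hn.1, hn.2.2⟩)
      (bounds.mono fun n hn => hn.2.2.2.2.2 δ) (discUp δ h0 h1)
      (bounds.mono fun n hn => hn.2.2.2.2.1 δ)
  · exact isTheta_sInf_cont hC hM (bounds.mono fun n hn => hn.1.2.2)
      (bounds.mono fun n hn => hn.2.1) (bounds.mono fun n hn => hn.2.2.1) hε hε2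
  · exact isTheta_sInf_disc (discC δ h0 h1) hM
      ((discGap δ h0 h1).mono fun n hn => hn.2) (discUp δ h0 h1)
      (bounds.mono fun n hn => hn.2.2.2.2.1 δ) hε hε2
  · refine isTheta_of_le_of_le (a := 1 / C) (b := C) (one_div_pos.2 hC) ?_
    filter_upwards [bounds, gap_nonneg, hM.eventually_gt_atTop 0] with n hn hg hMn
    refine ⟨hMn.le, ?_, ?_⟩
    · rw [div_mul_eq_mul_div, one_mul, div_le_div_iff₀ hC hg]
      linarith [hn.1.2.2]
    · rw [div_le_iff₀ hg]
      have := hn.1.1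
      rw [div_le_iff₀ (mul_pos hC hMn)] at this
      linarith

end BirthDeath
namespace BirthDeath

/-! ### Families of chains with a valley -/

theorem mixing_of_valley {p q r π : ∀ n : ℕ, Fin (n + 1) → ℝ} {j : ∀ n : ℕ, Fin (n + 1)} {κ c : ℝ}
    (hκ : 0 < κ) (hc : 0 < c)
    (h : ∀ᶠ n in atTop, IsReversibleRates (p n) (q n) (r n) (π n) ∧ DistValley (π n) (j n) ∧
      (0 < j n ∧ j n < Fin.last n ∧ c ≤ ∑ i ∈ Finset.Iic (j n), π n i ∧
        c ≤ ∑ i ∈ Finset.Ici (j n), π n i) ∧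
      (∀ i ∈ Set.Ioc 0 (j n), ∀ k ∈ Set.Ioc 0 (j n), q n i ≤ κ * q n k) ∧
      (∀ i ∈ Set.Ico (j n) (Fin.last n), ∀ k ∈ Set.Ico (j n) (Fin.last n), p n i ≤ κ * p n k)) :
    let M : ℕ → ℝ := fun n => max (1 / q n (j n) * ∑ i ∈ Finset.Iic (j n), 1 / π n i)
      (1 / p n (j n) * ∑ i ∈ Finset.Ici (j n), 1 / π n i)
    ¬ HasPrecutoffCont (fun n => distCont (bdMatrix (p n) (q n) (r n)) (π n)) ∧
    (∀ δ : ℝ, 0 < δ → δ < 1 →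
      ¬ HasPrecutoffDisc (fun n => distDisc (lazyChain δ (bdMatrix (p n) (q n) (r n))) (π n))) ∧
    (∀ ε δ : ℝ, 0 < ε → ε < 1 / 2 → 0 < δ → δ < 1 →
      ((fun n => mixCont (bdMatrix (p n) (q n) (r n)) (π n) ε) =Θ[atTop] M) ∧
      ((fun n => (mixDisc (lazyChain δ (bdMatrix (p n) (q n) (r n))) (π n) ε : ℝ)) =Θ[atTop] M) ∧
      ((fun n => 1 / spectralGap (bdMatrix (p n) (q n) (r n))) =Θ[atTop] M)) := by
  intro M
  have hM : Tendsto M atTop atTop := by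
    refine tendsto_atTop_mono' _ (h.mono fun n hn => hn.1.le_max_slopes hn.2.2.1.1 hn.2.2.1.2.1) ?_
    exact (tendsto_atTop_add_const_right _ 1 tendsto_natCast_atTop_atTop).atTop_div_const two_pos
  refine mixing_of_gap_mul_le (C := 2 * κ + 16 * κ ^ 3 / c ^ 3) (by positivity) hM ?_
  filter_upwards [h, eventually_ge_atTop 1, hM.eventually_gt_atTop 0]
    with n ⟨hr, hv, ⟨hj0, hj, hL, hR⟩, hq, hp⟩ hn hMn
  have hjq : j n ∈ Set.Ioc 0 (j n) := ⟨hj0, le_rfl⟩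
  have hjp : j n ∈ Set.Ico (j n) (Fin.last n) := ⟨le_rfl, hj⟩
  have hpoin : ∀ g x, (g x - wip (π n) 1 g) ^ 2 ≤ (2 * κ + 16 * κ ^ 3 / c ^ 3) * M n
      * dform (bdMatrix (p n) (q n) (r n)) (π n) g := fun g x => by
    refine (hr.sq_sub_mean_le g x).trans
      (mul_le_mul_of_nonneg_right ?_ (hr.isReversible.dform_nonneg g))
    have h1 := hr.sum_resistance_le hj0 hj hκ (fun i h1 h2 => hq _ hjq i ⟨h1, h2⟩)
      (fun i h1 h2 => hp _ hjp i ⟨h1, h2⟩)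
    have h2 : 1 / q n (j n) * ∑ i ∈ Finset.Iic (j n), 1 / π n i ≤ M n := le_max_left _ _
    have h3 : 1 / p n (j n) * ∑ i ∈ Finset.Ici (j n), 1 / π n i ≤ M n := le_max_right _ _
    have h4 : 0 ≤ 16 * κ ^ 3 / c ^ 3 * M n := by positivity
    have h5 := mul_le_mul_of_nonneg_left h2 hκ.le
    have h6 := mul_le_mul_of_nonneg_left h3 hκ.le
    linarith
  have : Nontrivial (Fin (n + 1)) := Fin.nontrivial_iff_two_le.2 (by omega)
  refine ⟨this, hr.isReversible, hpoin, ?_⟩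
  obtain ⟨hg, -, -, ray⟩ := hr.isReversible.spectralGap_spec (by positivity) hpoin
  have hg0 : 0 ≤ spectralGap (bdMatrix (p n) (q n) (r n)) := le_trans (by positivity) hg
  have hleft := hr.gap_mul_left_le hg0 ray hj0 hv hκ hc (fun i h1 h2 => hq i ⟨h1, h2⟩ _ hjq)
    (fun i h1 h2 => hq _ hjq i ⟨h1, h2⟩) hL hR
  have hright := hr.gap_mul_right_le hg0 ray hj hv hκ hc (fun i h1 h2 => hp i ⟨h1, h2⟩ _ hjp)
    (fun i h1 h2 => hp _ hjp i ⟨h1, h2⟩) hL hR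
  simp only [M]
  rw [mul_max_of_nonneg _ _ hg0]
  exact (max_le hleft hright).trans (le_add_of_nonneg_left (by positivity))

/-- If the two slopes of a valley have comparable masses, then both masses are bounded below, and
the bottom of the valley is not an endpoint: at an endpoint one of the slopes is a single point,
which is the smallest atom and has mass at most `1 / (n + 1)`. -/
theorem exists_le_mass_of_isTheta {π : ∀ n : ℕ, Fin (n + 1) → ℝ} {j : ∀ n : ℕ, Fin (n + 1)}
    (hpos : ∀ n, 1 ≤ n → ∀ i, 0 < π n i) (hsum : ∀ n, 1 ≤ n → ∑ i, π n i = 1)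
    (hv : ∀ n, 1 ≤ n → DistValley (π n) (j n))
    (hΘ : (fun n => ∑ i ∈ Finset.Iic (j n), π n i) =Θ[atTop]
      (fun n => ∑ i ∈ Finset.Ici (j n), π n i)) :
    ∃ c : ℝ, 0 < c ∧ ∀ᶠ n in atTop, 0 < j n ∧ j n < Fin.last n ∧
      c ≤ ∑ i ∈ Finset.Iic (j n), π n i ∧ c ≤ ∑ i ∈ Finset.Ici (j n), π n i := by
  obtain ⟨C₁, hC₁, h1⟩ := hΘ.1.exists_pos
  obtain ⟨C₂, hC₂, h2⟩ := hΘ.2.exists_pos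
  have hc : 0 < 1 / (1 + C₁ + C₂) := by positivity
  refine ⟨1 / (1 + C₁ + C₂), hc, ?_⟩
  have small := (tendsto_one_div_add_atTop_nhds_zero_nat (𝕜 := ℝ)).eventually_lt_const hc
  filter_upwards [h1.bound, h2.bound, eventually_ge_atTop 1, small] with n b1 b2 hn hs
  set A := ∑ i ∈ Finset.Iic (j n), π n i with hA
  set B := ∑ i ∈ Finset.Ici (j n), π n i with hB
  have hA0 : 0 ≤ A := Finset.sum_nonneg fun i _ => (hpos n hn i).le
  have hB0 : 0 ≤ B := Finset.sum_nonneg fun i _ => (hpos n hn i).le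
  rw [Real.norm_of_nonneg hA0, Real.norm_of_nonneg hB0] at b1 b2
  have total : 1 ≤ A + B := by
    calc (1 : ℝ) = ∑ i, π n i := (hsum n hn).symm
      _ = ∑ i ∈ Finset.Iic (j n) ∪ Finset.Ici (j n), π n i := by
          congr 1; ext i; simp [le_total]
      _ ≤ _ := by
          rw [hA, hB, ← Finset.sum_union_inter]
          exact le_add_of_nonneg_right (Finset.sum_nonneg fun i _ => (hpos n hn i).le)
  have cA : 1 / (1 + C₁ + C₂) ≤ A := by
    rw [div_le_iff₀ (by positivity)]
    nlinarith [mul_nonneg hA0 hC₁.le]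
  have cB : 1 / (1 + C₁ + C₂) ≤ B := by
    rw [div_le_iff₀ (by positivity)]
    nlinarith [mul_nonneg hB0 hC₂.le]
  have atom : ∀ x, (∀ y, π n x ≤ π n y) → π n x ≤ 1 / ((n : ℝ) + 1) := fun x hx => by
    rw [le_div_iff₀ (by positivity)]
    calc π n x * ((n : ℝ) + 1) = ∑ y : Fin (n + 1), π n x := by simp; ring
      _ ≤ ∑ y, π n y := Finset.sum_le_sum fun y _ => hx y
      _ = 1 := hsum n hn
  refine ⟨lt_of_le_of_ne (Fin.zero_le _) fun e => ?_, lt_of_le_of_ne (Fin.le_last _) fun e => ?_,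
    cA, cB⟩
  · have hmin : ∀ y, π n (j n) ≤ π n y := fun y =>
      (hv n hn).monotoneOn (by simp) (by simp [← e]) (by simp [← e])
    have e2 : A = π n (j n) := by
      rw [hA, ← e, Finset.sum_eq_single 0] <;> simp
    have := atom _ hmin
    linarith
  · have hmin : ∀ y, π n (j n) ≤ π n y := fun y =>
      (hv n hn).antitoneOn (by simp [e, Fin.le_last]) (by simp) (by simp [e, Fin.le_last])
    have e2 : B = π n (j n) := by
      rw [hB, e, Finset.sum_eq_single (Fin.last n)]
      · intro y hy hne
        exact absurd (Fin.last_le_iff.1 (by simpa using hy)) hne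
      · simp
    have := atom _ hmin
    linarith

theorem IsReversibleRates.distValley {n : ℕ} {p q r π : Fin (n + 1) → ℝ}
    (h : IsReversibleRates p q r π) {j : Fin (n + 1)} (hv : RatesValley p q j) :
    DistValley π j := by
  intro i
  have b := h.balance i
  have h1 := h.birth_pos i
  have h2 := h.death_pos i
  have h3 := h.pos i.castSucc
  have h4 := h.pos i.succ
  refine ⟨fun hi => ?_, fun hi => ?_⟩
  · refine le_of_mul_le_mul_right ?_ h2
    rw [← b]
    exact mul_le_mul_of_nonneg_left ((hv i).1 hi) h3.le
  · refine le_of_mul_le_mul_right ?_ h1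
    rw [b]
    exact mul_le_mul_of_nonneg_left ((hv i).2 hi) h4.le

theorem exists_le_mul_of_isTheta {f : ∀ n : ℕ, Fin (n + 1) → ℝ} {s : ∀ n : ℕ, Set (Fin (n + 1))}
    (hf : ∀ n, 1 ≤ n → ∀ i, 0 ≤ f n i)
    (h : (fun n => sSup (f n '' s n)) =Θ[atTop] (fun n => sInf (f n '' s n))) :
    ∃ κ : ℝ, 0 < κ ∧ ∀ᶠ n in atTop, ∀ i ∈ s n, ∀ k ∈ s n, f n i ≤ κ * f n k := by
  obtain ⟨κ, hκ, hb⟩ := h.1.exists_pos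
  refine ⟨κ, hκ, ?_⟩
  filter_upwards [hb.bound, eventually_ge_atTop 1] with n hn h1 i hi k hk
  have fin : (f n '' s n).Finite := Set.toFinite _
  have hi' : f n i ≤ sSup (f n '' s n) := le_csSup fin.bddAbove ⟨i, hi, rfl⟩
  have hk' : sInf (f n '' s n) ≤ f n k := csInf_le fin.bddBelow ⟨k, hk, rfl⟩
  have h0 : 0 ≤ sInf (f n '' s n) := by
    refine Real.sInf_nonneg ?_
    rintro _ ⟨x, -, rfl⟩
    exact hf n h1 x
  rw [Real.norm_of_nonneg h0] at hn
  calc f n i ≤ ‖sSup (f n '' s n)‖ := hi'.trans (le_abs_self _)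
    _ ≤ κ * sInf (f n '' s n) := hn
    _ ≤ _ := mul_le_mul_of_nonneg_left hk' hκ.le

/-! ### Metropolis chains -/

section Metropolis

variable {n : ℕ} {π : Fin (n + 1) → ℝ} {j : Fin (n + 1)}

theorem metropolisBirth_castSucc (i : Fin n) : metropolisBirth π j i.castSucc
    = if j ≤ i.castSucc then 1 / 2 else π i.succ / (2 * π i.castSucc) := by
  rw [metropolisBirth, if_neg (Fin.castSucc_ne_last i), Fin.coeSucc_eq_succ]

theorem metropolisDeath_succ (i : Fin n) : metropolisDeath π j i.succ
    = if i.succ ≤ j then 1 / 2 else π i.castSucc / (2 * π i.succ) := by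
  rw [metropolisDeath, if_neg (Fin.succ_ne_zero i)]
  congr 3
  rw [← Fin.coeSucc_eq_succ, add_sub_cancel_right]

theorem isReversibleRates_metropolis (hpos : ∀ i, 0 < π i) (hsum : ∑ i, π i = 1)
    (hv : DistValley π j) :
    IsReversibleRates (metropolisBirth π j) (metropolisDeath π j)
      (fun i => 1 - metropolisBirth π j i - metropolisDeath π j i) π := by
  have hb : ∀ i : Fin n, 0 < metropolisBirth π j i.castSucc ∧
      metropolisBirth π j i.castSucc ≤ 1 / 2 := fun i => by
    have h1 := hpos i.castSucc
    have h2 := hpos i.succ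
    rw [metropolisBirth_castSucc]
    split_ifs with hi
    · norm_num
    · have := (hv i).1 (not_le.1 hi)
      refine ⟨by positivity, ?_⟩
      rw [div_le_div_iff₀ (by positivity) two_pos]
      linarith
  have hd : ∀ i : Fin n, 0 < metropolisDeath π j i.succ ∧
      metropolisDeath π j i.succ ≤ 1 / 2 := fun i => by
    have h1 := hpos i.castSucc
    have h2 := hpos i.succ
    rw [metropolisDeath_succ]
    split_ifs with hi
    · norm_num
    · have := (hv i).2 (Fin.le_castSucc_iff.2 (not_le.1 hi))
      refine ⟨by positivity, ?_⟩
      rw [div_le_div_iff₀ (by positivity) two_pos]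
      linarith
  have bl : metropolisBirth π j (Fin.last n) = 0 := by simp [metropolisBirth]
  have dz : metropolisDeath π j 0 = 0 := by simp [metropolisDeath]
  have hb' : ∀ i, 0 ≤ metropolisBirth π j i ∧ metropolisBirth π j i ≤ 1 / 2 := fun i => by
    induction i using Fin.lastCases with
    | last => rw [bl]; norm_num
    | cast i => exact ⟨(hb i).1.le, (hb i).2⟩
  have hd' : ∀ i, 0 ≤ metropolisDeath π j i ∧ metropolisDeath π j i ≤ 1 / 2 := fun i => by
    induction i using Fin.cases with
    | zero => rw [dz]; norm_num
    | succ i => exact ⟨(hd i).1.le, (hd i).2⟩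
  refine ⟨⟨fun i => (hb' i).1, fun i => (hd' i).1, fun i => ?_, fun i => by ring, bl, dz⟩,
    fun i => (hb i).1, fun i => (hd i).1, hpos, hsum, fun i => ?_⟩
  · linarith [(hb' i).2, (hd' i).2]
  · have h1 := (hpos i.castSucc).ne'
    have h2 := (hpos i.succ).ne'
    rw [metropolisBirth_castSucc, metropolisDeath_succ]
    by_cases hi : j ≤ i.castSucc
    · rw [if_pos hi, if_neg (not_le.2 (Fin.le_castSucc_iff.1 hi))]
      field_simp
    · rw [if_neg hi, if_pos (Fin.castSucc_lt_iff_succ_le.1 (not_le.1 hi))]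
      field_simp

theorem metropolisDeath_eq_half {i : Fin (n + 1)} (h0 : 0 < i) (hi : i ≤ j) :
    metropolisDeath π j i = 1 / 2 := by
  rw [metropolisDeath, if_neg h0.ne', if_pos hi]

theorem metropolisBirth_eq_half {i : Fin (n + 1)} (hi : j ≤ i) (hl : i < Fin.last n) :
    metropolisBirth π j i = 1 / 2 := by
  rw [metropolisBirth, if_neg hl.ne, if_pos hi]

end Metropolis

end BirthDeath

theorem theorem4p3 :
    -- families of birth and death chains with a valley
    (∀ (p q r π : ∀ n : ℕ, Fin (n + 1) → ℝ) (j : ∀ n : ℕ, Fin (n + 1)),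
      (∀ n, 1 ≤ n → IsRates (p n) (q n) (r n)) →
      (∀ n, 1 ≤ n → (bdMatrix (p n) (q n) (r n)).IsIrreducible) →
      (∀ n, 1 ≤ n → IsStationaryDist (bdMatrix (p n) (q n) (r n)) (π n)) →
      (∀ n, 1 ≤ n → RatesValley (p n) (q n) (j n)) →
      ((fun n => ∑ i ∈ Finset.Iic (j n), π n i) =Θ[atTop]
        (fun n => ∑ i ∈ Finset.Ici (j n), π n i)) →
      ((fun n => sSup (q n '' Set.Ioc 0 (j n))) =Θ[atTop]
        (fun n => sInf (q n '' Set.Ioc 0 (j n)))) →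
      ((fun n => sSup (p n '' Set.Ico (j n) (Fin.last n))) =Θ[atTop]
        (fun n => sInf (p n '' Set.Ico (j n) (Fin.last n)))) →
      (¬ HasCutoffCont (fun n => distCont (bdMatrix (p n) (q n) (r n)) (π n))) ∧
      (∀ δ : ℝ, 0 < δ → δ < 1 →
        ¬ HasCutoffDisc (fun n => distDisc (lazyChain δ (bdMatrix (p n) (q n) (r n))) (π n))) ∧
      (∀ ε δ : ℝ, 0 < ε → ε < 1 / 2 → 0 < δ → δ < 1 →
        ((fun n => mixCont (bdMatrix (p n) (q n) (r n)) (π n) ε) =Θ[atTop]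
          (fun n => (mixDisc (lazyChain δ (bdMatrix (p n) (q n) (r n))) (π n) ε : ℝ))) ∧
        ((fun n => (mixDisc (lazyChain δ (bdMatrix (p n) (q n) (r n))) (π n) ε : ℝ)) =Θ[atTop]
          (fun n => 1 / spectralGap (bdMatrix (p n) (q n) (r n)))) ∧
        ((fun n => 1 / spectralGap (bdMatrix (p n) (q n) (r n))) =Θ[atTop]
          (fun n => max (1 / q n (j n) * ∑ i ∈ Finset.Iic (j n), 1 / π n i)
            (1 / p n (j n) * ∑ i ∈ Finset.Ici (j n), 1 / π n i))))) ∧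
    -- families of Metropolis chains
    (∀ (π : ∀ n : ℕ, Fin (n + 1) → ℝ) (j : ∀ n : ℕ, Fin (n + 1)),
      (∀ n, 1 ≤ n → ∀ i, 0 < π n i) →
      (∀ n, 1 ≤ n → ∑ i, π n i = 1) →
      (∀ n, 1 ≤ n → DistValley (π n) (j n)) →
      ((fun n => ∑ i ∈ Finset.Iic (j n), π n i) =Θ[atTop]
        (fun n => ∑ i ∈ Finset.Ici (j n), π n i)) →
      (¬ HasPrecutoffCont (fun n => distCont (metropolis (π n) (j n)) (π n))) ∧
      (∀ δ : ℝ, 0 < δ → δ < 1 →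
        ¬ HasPrecutoffDisc (fun n => distDisc (lazyChain δ (metropolis (π n) (j n))) (π n))) ∧
      (∀ ε δ : ℝ, 0 < ε → ε < 1 / 2 → 0 < δ → δ < 1 →
        ((fun n => mixCont (metropolis (π n) (j n)) (π n) ε) =Θ[atTop]
          (fun n => ∑ i, 1 / π n i)) ∧
        ((fun n => (mixDisc (lazyChain δ (metropolis (π n) (j n))) (π n) ε : ℝ)) =Θ[atTop]
          (fun n => ∑ i, 1 / π n i)) ∧
        ((fun n => 1 / spectralGap (metropolis (π n) (j n))) =Θ[atTop]
          (fun n => ∑ i, 1 / π n i)))) := by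
  refine ⟨?_, ?_⟩
  · intro p q r π j hrates hirr hstat hvalley hmass hq hp
    have hrr : ∀ n, 1 ≤ n → IsReversibleRates (p n) (q n) (r n) (π n) := fun n hn =>
      (hstat n hn).isReversibleRates (hrates n hn) (hirr n hn)
    have hv : ∀ n, 1 ≤ n → DistValley (π n) (j n) := fun n hn =>
      (hrr n hn).distValley (hvalley n hn)
    obtain ⟨c, hc, hcm⟩ := exists_le_mass_of_isTheta (fun n hn => (hrr n hn).pos)
      (fun n hn => (hrr n hn).sum_eq_one) hv hmass
    obtain ⟨κ₁, hκ₁, h1⟩ := exists_le_mul_of_isTheta (fun n hn => (hrates n hn).death_nonneg) hq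
    obtain ⟨κ₂, hκ₂, h2⟩ := exists_le_mul_of_isTheta (fun n hn => (hrates n hn).birth_nonneg) hp
    obtain ⟨m1, m2, m3⟩ := mixing_of_valley (p := p) (q := q) (r := r) (π := π) (j := j)
      (add_pos hκ₁ hκ₂) hc (by
        filter_upwards [eventually_ge_atTop 1, hcm, h1, h2] with n hn a1 a2 a3
        refine ⟨hrr n hn, hv n hn, a1, fun i hi k hk => (a2 i hi k hk).trans ?_,
          fun i hi k hk => (a3 i hi k hk).trans ?_⟩
        · exact mul_le_mul_of_nonneg_right (by linarith) ((hrates n hn).death_nonneg k)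
        · exact mul_le_mul_of_nonneg_right (by linarith) ((hrates n hn).birth_nonneg k))
    refine ⟨fun h => m1 h.hasPrecutoffCont, fun δ h0 h1 h => m2 δ h0 h1 h.hasPrecutoffDisc,
      fun ε δ hε hε2 h0 h1 => ?_⟩
    obtain ⟨t1, t2, t3⟩ := m3 ε δ hε hε2 h0 h1
    exact ⟨t1.trans t2.symm, t2.trans t3.symm, t3⟩
  · intro π j hpos hsum hv hmass
    obtain ⟨c, hc, hcm⟩ := exists_le_mass_of_isTheta hpos hsum hv hmass
    obtain ⟨m1, m2, m3⟩ := mixing_of_valley (p := fun n => metropolisBirth (π n) (j n))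
      (q := fun n => metropolisDeath (π n) (j n))
      (r := fun n i => 1 - metropolisBirth (π n) (j n) i - metropolisDeath (π n) (j n) i)
      (π := π) (j := j) one_pos hc (by
        filter_upwards [eventually_ge_atTop 1, hcm] with n hn a1
        refine ⟨isReversibleRates_metropolis (hpos n hn) (hsum n hn) (hv n hn), hv n hn, a1,
          fun i hi k hk => ?_, fun i hi k hk => ?_⟩
        · rw [metropolisDeath_eq_half hi.1 hi.2, metropolisDeath_eq_half hk.1 hk.2, one_mul]
        · rw [metropolisBirth_eq_half hi.1 hi.2, metropolisBirth_eq_half hk.1 hk.2, one_mul])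
    -- the rates at the bottom of the valley are `1 / 2`, so the maximum over the two slopes is
    -- comparable to the whole sum
    have hM : (fun n => max
        (1 / metropolisDeath (π n) (j n) (j n) * ∑ i ∈ Finset.Iic (j n), 1 / π n i)
        (1 / metropolisBirth (π n) (j n) (j n) * ∑ i ∈ Finset.Ici (j n), 1 / π n i))
        =Θ[atTop] fun n => ∑ i, 1 / π n i := by
      refine isTheta_of_le_of_le (a := 1) (b := 2) one_pos ?_
      filter_upwards [eventually_ge_atTop 1, hcm] with n hn a1
      have hw : ∀ i, 0 ≤ 1 / π n i := fun i => (one_div_pos.2 (hpos n hn i)).le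
      rw [metropolisDeath_eq_half a1.1 le_rfl, metropolisBirth_eq_half le_rfl a1.2.1]
      have total : ∑ i, 1 / π n i
          ≤ ∑ i ∈ Finset.Iic (j n), 1 / π n i + ∑ i ∈ Finset.Ici (j n), 1 / π n i := by
        rw [← Finset.sum_union_inter, show Finset.Iic (j n) ∪ Finset.Ici (j n) = Finset.univ by
          ext i; simp [le_total]]
        exact le_add_of_nonneg_right (Finset.sum_nonneg fun i _ => hw i)
      have l1 : ∑ i ∈ Finset.Iic (j n), 1 / π n i ≤ ∑ i, 1 / π n i :=
        Finset.sum_le_sum_of_subset_of_nonneg (Finset.subset_univ _) fun i _ _ => hw i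
      have l2 : ∑ i ∈ Finset.Ici (j n), 1 / π n i ≤ ∑ i, 1 / π n i :=
        Finset.sum_le_sum_of_subset_of_nonneg (Finset.subset_univ _) fun i _ _ => hw i
      refine ⟨Finset.sum_nonneg fun i _ => hw i, ?_, max_le (by linarith) (by linarith)⟩
      have x1 := le_max_left (1 / (1 / 2 : ℝ) * ∑ i ∈ Finset.Iic (j n), 1 / π n i)
        (1 / (1 / 2 : ℝ) * ∑ i ∈ Finset.Ici (j n), 1 / π n i)
      have x2 := le_max_right (1 / (1 / 2 : ℝ) * ∑ i ∈ Finset.Iic (j n), 1 / π n i)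
        (1 / (1 / 2 : ℝ) * ∑ i ∈ Finset.Ici (j n), 1 / π n i)
      linarith
    refine ⟨m1, m2, fun ε δ hε hε2 h0 h1 => ?_⟩
    obtain ⟨t1, t2, t3⟩ := m3 ε δ hε hε2 h0 h1
    exact ⟨t1.trans hM, t2.trans hM, t3.trans hM⟩
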